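/- For each sample size $n$ consider the Gaussian linear mixed model $$Y=\mu+Z\nu+W\gamma+\epsilon\in\mathbb{R}^n ,$$ with random effects designs $Z\in\mathbb{R}^{n\times v}$, $W\in\mathbb{R}^{n\times r}$ and a fixed effects design $X\in\mathbb{R}^{n\times p}$, $p>n$, where all quantities except the constant $\sigma_\epsilon^2>0$ may depend on $n$. Here $\epsilon\sim\mathcal{N}_n(0,\sigma_\epsilon^2 I_n)$, $\nu\sim\mathcal{N}_v(0,\Psi)$ with $\Psi$ positive semi-definite, and $\gamma$ is an arbitrary nuisance vector. Let $A\in\mathbb{R}^{n_a\times n}$ and $B\in\mathbb{R}^{n_b\times n}$ have orthonormal rows, with $n_a,n_b\ge 1$ for all large $n$, and satisfy $AB^{\mathsf T}=0$, $AW=0$, $BW=0$, $BZ=0$; put $Q=\begin{pmatrix}A\\B\end{pmatrix}$. The tuple $(X,Z,W,\mu,A,B)$ may be random, but is independent of $\epsilon$; nothing else is assumed on the design $X$. For $u\in\mathbb{N}$ let $\mathcal{M}_u$ be the collection of the sets of $u$ columns of $X$. For $m\in\mathcal{M}_u$ let $P_m^\perp$ be the orthogonal projection of $\mathbb{R}^n$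 onto the orthogonal complement of the span of the columns of $X$ indexed by $m$, and let $\hat\beta_{m,Q}\in\mathbb{R}^p$ be a least squares estimator from the data $(QX,QY)$ with support in $m$. For $\alpha>0$ define $$w_{m,Q}=\frac{\exp\left(-\frac1\alpha\|QY-QX\hat\beta_{m,Q}\|^2\right)}{\sum_{k\in\mathcal{M}_u}\exp\left(-\frac1\alpha\|QY-QX\hat\beta_{k,Q}\|^2\right)},\qquad \hat\beta_{\mathrm{EW},Q}=\sum_{m\in\mathcal{M}_u}w_{m,Q}\hat\beta_{m,Q},$$ $$F_{\mathrm{EW}}=\frac{\|AY-AX\hat\beta_{\mathrm{EW},Q}\|^2/n_a}{\|BY-BX\hat\beta_{\mathrm{EW},Q}\|^2/n_b}.$$ Assume that $\mu$ is weakly sparse relative to $X$ with sparsity $s$ at rate $n_a\wedge n_b$, that is, there are $S\in\mathcal{M}_s$ (possibly depending on the realization) with $\|P_S^\perp\mu\|^2=o_{\mathbb P}(n_a\wedge n_b)$ (which is $o(n_a\wedge n_b)$ if $X$, $\mu$, $S$ are not random). Assume $$\text{(A2)}\qquad \liminf_{n\to\infty}(u-s)\ge 0,\qquad \lim_{n\to\infty}\frac{u\log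 p}{n_a\wedge n_b}=0,$$ and that the tuning parameter satisfies $\alpha\ge 4\sigma_\epsilon^2$ and is bounded in $n$ (for instance constant). Then, under the null hypothesis $H_0:\Psi=0$, there are random variables $F=F_n$, defined on the same probability spaces, such that $F$ has exactly the $F_{n_a,n_b}$ distribution whenever $n_a,n_b\ge1$, and $$F_{\mathrm{EW}}=F+o_{\mathbb P}(1)\qquad(n\to\infty).$$ -/

import Mathlib

open MeasureTheory ProbabilityTheory Filter Topology

noncomputable section

/-- Squared Euclidean norm `‖x‖²` of a coordinate vector. -/
def sqNorm {ι : Type*} [Fintype ι] (x : ι → ℝ) : ℝ := ∑ i, x i ^ 2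

/-- The chi-squared distribution with `d` degrees of freedom: the law of the sum of the squares
of `d` independent standard normal variables. -/
def chiSquared (d : ℕ) : Measure ℝ :=
  (Measure.pi fun _ : Fin d => gaussianReal 0 1).map fun x => ∑ i, x i ^ 2

/-- The `F` distribution with `a` and `b` degrees of freedom: the law of `(U / a) / (V / b)` for
independent chi-squared variables `U`, `V` with `a` and `b` degrees of freedom. -/
def fDistribution (a b : ℕ) : Measure ℝ :=
  ((chiSquared a).prod (chiSquared b)).map fun z => (z.1 / a) / (z.2 / b)

/-- The models of size `u`: the sets of `u` of the `p` columns of the fixed effects design. -/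
def models (p u : ℕ) : Finset (Finset (Fin p)) := Finset.powersetCard u Finset.univ

/-- The span of the columns of `X` indexed by `m`. -/
def colSpan {n p : ℕ} (X : Matrix (Fin n) (Fin p) ℝ) (m : Finset (Fin p)) :
    Submodule ℝ (EuclideanSpace ℝ (Fin n)) :=
  Submodule.span ℝ ((fun j => WithLp.toLp 2 (fun i => X i j)) '' (m : Set (Fin p)))

/-- `‖P_m^⊥ μ‖²`, where `P_m^⊥` is the orthogonal projection onto the orthogonal complement of the
span of the columns of `X` indexed by `m`. -/
def modelBias {n p : ℕ} (X : Matrix (Fin n) (Fin p) ℝ) (m : Finset (Fin p)) (μ : Fin n → ℝ) : ℝ :=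
  ‖(colSpan X m)ᗮ.starProjection (WithLp.toLp 2 μ)‖ ^ 2

/-- Convergence to zero in probability, `V n = o_P(1)`, where `V n` may live on its own
probability space. -/
def IsLittleOP {Ω : ℕ → Type*} [∀ n, MeasurableSpace (Ω n)] (P : ∀ n, Measure (Ω n))
    (V : ∀ n, Ω n → ℝ) : Prop :=
  ∀ δ : ℝ, 0 < δ → Tendsto (fun n => P n {ω | δ ≤ |V n ω|}) atTop (𝓝 0)

/-- The (possibly random) vectors `μ n` are weakly sparse relative to the (possibly random)
designs `X n`, with sparsity `s n` at rate `k n`: for some models `S n` of size `s n`, which may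
vary with the realization, `‖P_S^⊥ μ‖² = o_P(k)`. For non-random `X`, `μ` and `S` this says
`‖P_S^⊥ μ‖² = o(k)`. -/
def WeaklySparse {Ω : ℕ → Type*} [∀ n, MeasurableSpace (Ω n)] (P : ∀ n, Measure (Ω n))
    {p : ℕ → ℕ} (X : ∀ n, Ω n → Matrix (Fin n) (Fin (p n)) ℝ) (μ : ∀ n, Ω n → Fin n → ℝ)
    (s : ℕ → ℕ) (k : ℕ → ℝ) : Prop :=
  ∃ S : ∀ n, Ω n → Finset (Fin (p n)), (∀ n ω, S n ω ∈ models (p n) (s n)) ∧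
    IsLittleOP P fun n ω => modelBias (X n ω) (S n ω) (μ n ω) / k n

/-- `b` is a least squares estimator for the response `y` and the covariates formed by the columns
of `M` indexed by `m`, regarded as a vector that vanishes outside `m`. -/
def IsLeastSquares {ι κ : Type*} [Fintype ι] [Fintype κ] (M : Matrix ι κ ℝ) (y : ι → ℝ)
    (m : Finset κ) (b : κ → ℝ) : Prop :=
  (∀ j, j ∉ m → b j = 0) ∧
    ∀ c : κ → ℝ, (∀ j, j ∉ m → c j = 0) → sqNorm (y - M.mulVec b) ≤ sqNorm (y - M.mulVec c)

/-- The exponential weight of the model `m` among the models of size `u`, where `b k` is the least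
squares estimator in the model `k`. -/
def expWeight {ι : Type*} [Fintype ι] {p : ℕ} (α : ℝ) (u : ℕ) (M : Matrix ι (Fin p) ℝ)
    (y : ι → ℝ) (b : Finset (Fin p) → Fin p → ℝ) (m : Finset (Fin p)) : ℝ :=
  Real.exp (-(1 / α) * sqNorm (y - M.mulVec (b m))) /
    ∑ k ∈ models p u, Real.exp (-(1 / α) * sqNorm (y - M.mulVec (b k)))

/-- The exponentially weighted estimator of the fixed effects. -/
def betaEW {ι : Type*} [Fintype ι] {p : ℕ} (α : ℝ) (u : ℕ) (M : Matrix ι (Fin p) ℝ)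
    (y : ι → ℝ) (b : Finset (Fin p) → Fin p → ℝ) : Fin p → ℝ :=
  ∑ m ∈ models p u, expWeight α u M y b m • b m

/-- The exponentially weighted `F`-statistic. The weights are computed from the data `(QX, QY)`,
with `Q` the matrix `A` stacked on top of `B`, and `b m` is the least squares estimator in the
model `m` for these data. -/
def fEW {n p na nb : ℕ} (α : ℝ) (u : ℕ) (A : Matrix (Fin na) (Fin n) ℝ)
    (B : Matrix (Fin nb) (Fin n) ℝ) (X : Matrix (Fin n) (Fin p) ℝ) (Y : Fin n → ℝ)
    (b : Finset (Fin p) → Fin p → ℝ) : ℝ :=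
  let Q := Matrix.fromRows A B
  let β := betaEW α u (Q * X) (Q.mulVec Y) b
  (sqNorm (A.mulVec Y - (A * X).mulVec β) / na) / (sqNorm (B.mulVec Y - (B * X).mulVec β) / nb)

end

/-! Under the null hypothesis `ν` vanishes almost surely, and `A`, `B` annihilate `W`, so `QY = Qμ +
σ Qe` with `e` standard Gaussian and independent of the design. As `Q Qᵀ = 1`, `Qe` is standard
Gaussian given the design, hence unconditionally, and the ratio `F` of the mean squares of `Ae` and
`Be` has exactly the F law. After cancelling `σ²`, the statistic is the same ratio with `Qe` shifted
by `σ⁻¹(Qμ - QXβ)`, where `β` is the exponentially weighted estimator. Two facts remain.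

Stability (`isLittleOP_meanSquare_ratio`): mean squares of Gaussian vectors are bounded, and bounded
away from zero, in probability uniformly in the dimension. A shift of squared norm `o_P(na ∧ nb)`
therefore moves the ratio by `o_P(1)`, even if the dimensions stay bounded.

Consistency (`isLittleOP_sqNorm_mulVec_sub_mulVec_betaEW`): `‖Qμ - QXβ‖² = o_P(na ∧ nb)`. By Gibbs'
inequality the weighted mean of the residual sums of squares exceeds the smallest one by at most `α
log |M_u| ≤ α u log p`. Residuals and prediction errors differ by a cross term with the noise, which
must be controlled for all models and coefficients at once. In each model the errors lie in a fixed
subspace of dimension at most `u + 1`, so a chi-squared tail and a union bound over at most `p ^ u`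
models suffice (`stdGaussian_isCorrelated_le`). -/

/-! ### Standard Gaussian vectors: exponential moments and tails of the squared norm. -/

section StandardGaussian

open scoped RealInnerProductSpace

variable {E : Type*} [NormedAddCommGroup E] [InnerProductSpace ℝ E] [FiniteDimensional ℝ E]
  [MeasurableSpace E] [BorelSpace E]

/-- A linear map with `L L† = 1` maps a standard Gaussian vector to a standard Gaussian vector. -/
theorem map_stdGaussian_of_comp_adjoint_eq_id {F : Type*} [NormedAddCommGroup F]
    [InnerProductSpace ℝ F] [FiniteDimensional ℝ F] [MeasurableSpace F] [BorelSpace F]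
    (L : E →L[ℝ] F) (hL : L ∘L ContinuousLinearMap.adjoint L = ContinuousLinearMap.id ℝ F) :
    (stdGaussian E).map L = stdGaussian F := by
  have : IsProbabilityMeasure ((stdGaussian E).map L) :=
    Measure.isProbabilityMeasure_map (by fun_prop)
  apply Measure.ext_of_charFun
  ext t
  have h : charFun ((stdGaussian E).map L) t
      = charFun (stdGaussian E) (ContinuousLinearMap.adjoint L t) := by
    rw [charFun_apply, charFun_apply, integral_map (by fun_prop) (by fun_prop)]
    simp_rw [ContinuousLinearMap.adjoint_inner_right]
  have hn : ‖ContinuousLinearMap.adjoint L t‖ ^ 2 = ‖t‖ ^ 2 := by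
    rw [← real_inner_self_eq_norm_sq, ContinuousLinearMap.adjoint_inner_left,
      ← ContinuousLinearMap.comp_apply, hL, ContinuousLinearMap.id_apply,
      real_inner_self_eq_norm_sq]
  rw [h, charFun_stdGaussian, charFun_stdGaussian]
  norm_cast
  rw [hn]

theorem multivariateGaussian_zero_sq_smul_one {ι : Type*} [Fintype ι] [DecidableEq ι] (σ : ℝ) :
    multivariateGaussian 0 (σ ^ 2 • (1 : Matrix ι ι ℝ))
      = (stdGaussian (EuclideanSpace ℝ ι)).map (fun x => σ • x) := by
  have : IsProbabilityMeasure ((stdGaussian (EuclideanSpace ℝ ι)).map (fun x => σ • x)) :=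
    Measure.isProbabilityMeasure_map (by fun_prop)
  apply Measure.ext_of_charFun
  ext t
  rw [charFun_multivariateGaussian (Matrix.PosSemidef.one.smul (sq_nonneg σ)), charFun_map_smul,
    charFun_stdGaussian]
  congr 1
  have h : t ⬝ᵥ (σ ^ 2 • (1 : Matrix ι ι ℝ)).mulVec t = ‖σ • t‖ ^ 2 := by
    rw [norm_smul, mul_pow, Real.norm_eq_abs, sq_abs, EuclideanSpace.real_norm_sq_eq]
    simp only [Matrix.smul_mulVec, Matrix.one_mulVec, dotProduct, Pi.smul_apply, smul_eq_mul,
      Finset.mul_sum]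
    exact Finset.sum_congr rfl fun i _ => by ring
  rw [h, inner_zero_right]
  push_cast
  ring

theorem mgf_sq_gaussianReal {a : ℝ} (ha : a < 1 / 2) :
    ∫ x, Real.exp (a * x ^ 2) ∂(gaussianReal 0 1) = (√(1 - 2 * a))⁻¹ := by
  rw [integral_gaussianReal_eq_integral_smul one_ne_zero]
  have h : ∀ x : ℝ, gaussianPDFReal 0 1 x • Real.exp (a * x ^ 2)
      = (√(2 * Real.pi))⁻¹ * Real.exp (-(1 / 2 - a) * x ^ 2) := by
    intro x
    rw [gaussianPDFReal, smul_eq_mul, mul_assoc, ← Real.exp_add]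
    simp only [NNReal.coe_one, mul_one, sub_zero]
    congr 2
    ring
  simp_rw [h]
  rw [integral_const_mul, integral_gaussian, ← Real.sqrt_inv, ← Real.sqrt_inv,
    ← Real.sqrt_mul (by positivity)]
  congr 1
  have : 1 - 2 * a ≠ 0 := by linarith
  have : 1 / 2 - a ≠ 0 := by linarith
  have := Real.pi_ne_zero
  field_simp

theorem integral_exp_mul_normSq_stdGaussian {a : ℝ} (ha : a < 1 / 2) :
    ∫ x, Real.exp (a * ‖x‖ ^ 2) ∂(stdGaussian E) = (√(1 - 2 * a))⁻¹ ^ Module.finrank ℝ E := by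
  rw [stdGaussian_eq_map_pi_orthonormalBasis (stdOrthonormalBasis ℝ E),
    integral_map (Measurable.aemeasurable (by fun_prop)) (by fun_prop)]
  have h : ∀ x : Fin (Module.finrank ℝ E) → ℝ,
      Real.exp (a * ‖∑ i, x i • stdOrthonormalBasis ℝ E i‖ ^ 2)
        = ∏ i, Real.exp (a * x i ^ 2) := by
    intro x
    rw [← Real.exp_sum, ← Finset.mul_sum]
    congr 2
    have := (stdOrthonormalBasis ℝ E).sum_sq_inner_right (∑ i, x i • stdOrthonormalBasis ℝ E i)
    rw [← this]
    refine Finset.sum_congr rfl fun i _ => ?_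
    rw [Orthonormal.inner_right_fintype (stdOrthonormalBasis ℝ E).orthonormal]
  simp_rw [h]
  rw [integral_fintype_prod_eq_prod (f := fun _ (y : ℝ) => Real.exp (a * y ^ 2))]
  simp [mgf_sq_gaussianReal ha]

theorem integrable_exp_mul_normSq_stdGaussian {a : ℝ} (ha : a < 1 / 2) :
    Integrable (fun x => Real.exp (a * ‖x‖ ^ 2)) (stdGaussian E) := by
  -- The integral of a non-integrable function is zero by default, so a nonzero value proves
  -- integrability.
  apply Integrable.of_integral_ne_zero
  rw [integral_exp_mul_normSq_stdGaussian ha]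
  have : 0 < 1 - 2 * a := by linarith
  positivity

/-- Chernoff's bound at parameter `1 / 4`, where each coordinate contributes a factor `√2`. -/
theorem stdGaussian_normSq_ge_le (t : ℝ) :
    (stdGaussian E).real {x | t ≤ ‖x‖ ^ 2} ≤ Real.exp (-t / 4) * √2 ^ Module.finrank ℝ E := by
  refine (measure_ge_le_exp_mul_mgf (X := fun x : E => ‖x‖ ^ 2) (t := 1 / 4) t (by norm_num)
    (integrable_exp_mul_normSq_stdGaussian (by norm_num))).trans_eq ?_
  rw [mgf, integral_exp_mul_normSq_stdGaussian (by norm_num), ← Real.sqrt_inv]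
  congr 2
  · ring
  · norm_num

/-- Chernoff's bound at `-1 / (2c)`. The base of the power tends to zero with `c`, which makes the
bound useful in every positive dimension. -/
theorem stdGaussian_normSq_le_le {c : ℝ} (hc : 0 < c) :
    (stdGaussian E).real {x | ‖x‖ ^ 2 ≤ c * Module.finrank ℝ E}
      ≤ (Real.exp (1 / 2) * (√(1 + 1 / c))⁻¹) ^ Module.finrank ℝ E := by
  have h2 : -(1 / (2 * c)) < 1 / 2 := by
    have : 0 < 1 / (2 * c) := by positivity
    linarith
  refine (measure_le_le_exp_mul_mgf (X := fun x : E => ‖x‖ ^ 2) (t := -(1 / (2 * c))) _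
    (by simp; positivity) (integrable_exp_mul_normSq_stdGaussian h2)).trans_eq ?_
  rw [mgf, integral_exp_mul_normSq_stdGaussian h2, mul_pow, ← Real.exp_nat_mul]
  congr 2
  · field_simp
  · congr 2
    field_simp
    ring

/-- A bound for the largest normalized projection of a standard Gaussian vector on a subspace. -/
theorem stdGaussian_exists_inner_sq_gt_le (U : Submodule ℝ E) {t : ℝ} :
    stdGaussian E {x | ∃ w ∈ U, t * ‖w‖ ^ 2 < ⟪w, x⟫ ^ 2}
      ≤ ENNReal.ofReal (Real.exp (-t / 4) * √2 ^ Module.finrank ℝ U) := by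
  have hL : U.orthogonalProjectionOnto ∘L ContinuousLinearMap.adjoint U.orthogonalProjectionOnto
      = ContinuousLinearMap.id ℝ U := by
    rw [Submodule.adjoint_orthogonalProjectionOnto]
    ext x
    simp
  have hmap := map_stdGaussian_of_comp_adjoint_eq_id U.orthogonalProjectionOnto hL
  calc stdGaussian E {x | ∃ w ∈ U, t * ‖w‖ ^ 2 < ⟪w, x⟫ ^ 2}
      ≤ stdGaussian E (U.orthogonalProjectionOnto ⁻¹' {y : U | t ≤ ‖y‖ ^ 2}) := by
        -- Only the projection of `x` on `U` matters, and Cauchy–Schwarz bounds its norm below; the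
        -- strict inequality excludes `w = 0`.
        refine measure_mono ?_
        rintro x ⟨w, hw, h⟩
        have h1 : ⟪w, x⟫ = ⟪(⟨w, hw⟩ : U), U.orthogonalProjectionOnto x⟫ := by
          rw [Submodule.inner_orthogonalProjectionOnto_eq_of_mem_left]
        have h2 := abs_real_inner_le_norm (⟨w, hw⟩ : U) (U.orthogonalProjectionOnto x)
        rw [← h1, Submodule.coe_norm] at h2
        simp only [Set.mem_preimage, Set.mem_ofPred_eq]
        by_contra hlt
        push Not at hlt
        have h3 : ⟪w, x⟫ ^ 2 ≤ ‖w‖ ^ 2 * ‖U.orthogonalProjectionOnto x‖ ^ 2 := by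
          rw [← sq_abs, ← mul_pow]
          exact pow_le_pow_left₀ (abs_nonneg _) h2 2
        nlinarith [sq_nonneg ‖w‖]
    _ = stdGaussian U {y : U | t ≤ ‖y‖ ^ 2} := by
        rw [← hmap, Measure.map_apply (by fun_prop)]
        exact measurableSet_le measurable_const (by fun_prop)
    _ ≤ _ := by
        rw [← ENNReal.ofReal_toReal (measure_ne_top (stdGaussian U) _)]
        exact ENNReal.ofReal_le_ofReal (stdGaussian_normSq_ge_le t)

end StandardGaussian

/-! ### Deterministic oracle inequality for exponential weighting. -/

section Deterministic

theorem sqNorm_nonneg {ι : Type*} [Fintype ι] (x : ι → ℝ) : 0 ≤ sqNorm x :=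
  Finset.sum_nonneg fun _ _ => sq_nonneg _

theorem sqNorm_eq_dotProduct {ι : Type*} [Fintype ι] (x : ι → ℝ) : sqNorm x = x ⬝ᵥ x := by
  simp [sqNorm, dotProduct, pow_two]

theorem sqNorm_eq_norm_sq {ι : Type*} [Fintype ι] (x : ι → ℝ) :
    sqNorm x = ‖WithLp.toLp 2 x‖ ^ 2 := by
  simp [sqNorm, EuclideanSpace.real_norm_sq_eq]

theorem sqNorm_add {ι : Type*} [Fintype ι] (x y : ι → ℝ) :
    sqNorm (x + y) = sqNorm x + 2 * (x ⬝ᵥ y) + sqNorm y := by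
  simp only [sqNorm_eq_dotProduct, add_dotProduct, dotProduct_add, dotProduct_comm y x]
  ring

theorem sqNorm_smul {ι : Type*} [Fintype ι] (c : ℝ) (x : ι → ℝ) :
    sqNorm (c • x) = c ^ 2 * sqNorm x := by
  simp [sqNorm, mul_pow, Finset.mul_sum]

/-- Jensen's inequality for the squared norm. -/
theorem sqNorm_sum_smul_le {ι κ : Type*} [Fintype ι] {s : Finset κ} {w : κ → ℝ} (x : κ → ι → ℝ)
    (hw : ∀ k ∈ s, 0 ≤ w k) (hsum : ∑ k ∈ s, w k = 1) :
    sqNorm (∑ k ∈ s, w k • x k) ≤ ∑ k ∈ s, w k * sqNorm (x k) := by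
  simp only [sqNorm, Finset.mul_sum]
  rw [Finset.sum_comm]
  refine Finset.sum_le_sum fun i _ => ?_
  have h := (even_two.convexOn_pow (𝕜 := ℝ)).map_sum_le (p := fun k => x k i) hw hsum
    (fun _ _ => Set.mem_univ _)
  simpa [Finset.sum_apply] using h

/-- Gibbs' inequality: averaging with exponential weights is, up to the entropy of the uniform
distribution, as good as the best choice. -/
theorem sum_softmax_mul_le {κ : Type*} {s : Finset κ} (R : κ → ℝ) {α : ℝ} (hα : 0 < α) {i₀ : κ}
    (hi₀ : i₀ ∈ s) :
    ∑ i ∈ s, Real.exp (-(1 / α) * R i) / (∑ k ∈ s, Real.exp (-(1 / α) * R k)) * R i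
      ≤ R i₀ + α * Real.log s.card := by
  set Z := ∑ k ∈ s, Real.exp (-(1 / α) * R k) with hZ
  have hZ0 : 0 < Z := Finset.sum_pos (fun _ _ => Real.exp_pos _) ⟨i₀, hi₀⟩
  have hc : (0 : ℝ) < s.card := by exact_mod_cast Finset.card_pos.mpr ⟨i₀, hi₀⟩
  have hsum : ∑ i ∈ s, Real.exp (-(1 / α) * R i) / Z = 1 := by
    rw [← Finset.sum_div, div_self hZ0.ne']
  have hZi : Real.exp (-(1 / α) * R i₀) ≤ Z :=
    Finset.single_le_sum (f := fun k => Real.exp (-(1 / α) * R k))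
      (fun _ _ => (Real.exp_pos _).le) hi₀
  have hlogZ : -(1 / α) * R i₀ ≤ Real.log Z := by
    rw [← Real.log_exp (-(1 / α) * R i₀)]
    exact Real.log_le_log (Real.exp_pos _) hZi
  -- With `R i = -α (log w + log Z)`, this is `log x ≤ x - 1` at `x = 1 / (card * w)`. The
  -- corrections `1 / card - w` sum to zero, so the entropy is at most `log card`.
  have key : ∀ i ∈ s, Real.exp (-(1 / α) * R i) / Z * R i
      ≤ α * (Real.exp (-(1 / α) * R i) / Z * (Real.log s.card - Real.log Z)
        + (1 / s.card - Real.exp (-(1 / α) * R i) / Z)) := by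
    intro i _
    set w := Real.exp (-(1 / α) * R i) / Z with hw
    have hw0 : 0 < w := div_pos (Real.exp_pos _) hZ0
    have hlw : Real.log w = -(1 / α) * R i - Real.log Z := by
      rw [hw, Real.log_div (Real.exp_pos _).ne' hZ0.ne', Real.log_exp]
    have hR : R i = -α * (Real.log w + Real.log Z) := by
      rw [hlw]
      linear_combination -(R i) * mul_one_div_cancel hα.ne'
    have h1 : Real.log (1 / (s.card * w)) ≤ 1 / (s.card * w) - 1 :=
      Real.log_le_sub_one_of_pos (one_div_pos.mpr (mul_pos hc hw0))
    rw [one_div, Real.log_inv, Real.log_mul hc.ne' hw0.ne'] at h1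
    have h2 : w * (-(Real.log s.card + Real.log w)) ≤ w * ((s.card * w)⁻¹ - 1) :=
      mul_le_mul_of_nonneg_left h1 hw0.le
    have h3 : w * (((s.card : ℝ) * w)⁻¹ - 1) = 1 / s.card - w := by
      rw [mul_inv]
      linear_combination (s.card : ℝ)⁻¹ * mul_inv_cancel₀ hw0.ne'
    rw [h3] at h2
    rw [hR]
    have h4 : w * (-α * (Real.log w + Real.log Z)) = α * (w * (-(Real.log w + Real.log Z))) := by
      ring
    rw [h4]
    refine mul_le_mul_of_nonneg_left ?_ hα.le
    linarith
  refine (Finset.sum_le_sum key).trans ?_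
  rw [← Finset.mul_sum, Finset.sum_add_distrib, ← Finset.sum_mul, hsum, Finset.sum_sub_distrib,
    hsum, Finset.sum_const, nsmul_eq_mul, mul_one_div_cancel hc.ne']
  have : α * (-(1 / α) * R i₀) ≤ α * Real.log Z := mul_le_mul_of_nonneg_left hlogZ hα.le
  have h5 : α * (-(1 / α) * R i₀) = - R i₀ := by field_simp
  linarith

variable {ι : Type*} [Fintype ι] {p : ℕ}

theorem sum_expWeight_eq_one (α : ℝ) {u : ℕ} (M : Matrix ι (Fin p) ℝ) (y : ι → ℝ)
    (b : Finset (Fin p) → Fin p → ℝ) {m₀ : Finset (Fin p)} (hm₀ : m₀ ∈ models p u) :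
    ∑ m ∈ models p u, expWeight α u M y b m = 1 := by
  simp only [expWeight]
  rw [← Finset.sum_div, div_self]
  exact (Finset.sum_pos (fun _ _ => Real.exp_pos _) ⟨m₀, hm₀⟩).ne'

theorem expWeight_nonneg (α : ℝ) (u : ℕ) (M : Matrix ι (Fin p) ℝ) (y : ι → ℝ)
    (b : Finset (Fin p) → Fin p → ℝ) (m : Finset (Fin p)) : 0 ≤ expWeight α u M y b m :=
  div_nonneg (Real.exp_pos _).le (Finset.sum_nonneg fun _ _ => (Real.exp_pos _).le)

/-- Oracle inequality for exponential weighting, on the event that the noise `ζ` is not too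
strongly correlated with any of the approximation errors. -/
theorem sqNorm_sub_mulVec_betaEW_le {α t : ℝ} (hα : 0 < α) (ht : 0 ≤ t) {u : ℕ}
    (M : Matrix ι (Fin p) ℝ) (θ ζ : ι → ℝ) (b : Finset (Fin p) → Fin p → ℝ)
    (hb : ∀ m ∈ models p u, IsLeastSquares M (θ + ζ) m (b m))
    (hζ : ∀ m ∈ models p u, ∀ c : Fin p → ℝ, (∀ j, j ∉ m → c j = 0) →
      ((θ - M.mulVec c) ⬝ᵥ ζ) ^ 2 ≤ t * sqNorm (θ - M.mulVec c))
    {m₀ : Finset (Fin p)} (hm₀ : m₀ ∈ models p u) {c₀ : Fin p → ℝ}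
    (hc₀ : ∀ j, j ∉ m₀ → c₀ j = 0) :
    sqNorm (θ - M.mulVec (betaEW α u M (θ + ζ) b))
      ≤ 4 * sqNorm (θ - M.mulVec c₀) + 6 * t + 2 * (α * Real.log (models p u).card) := by
  set w := expWeight α u M (θ + ζ) b with hw
  have hsum : ∑ m ∈ models p u, w m = 1 := sum_expWeight_eq_one α M (θ + ζ) b hm₀
  have hw0 : ∀ m, 0 ≤ w m := expWeight_nonneg α u M (θ + ζ) b
  have hres : ∀ c : Fin p → ℝ, sqNorm (θ + ζ - M.mulVec c)
      = sqNorm (θ - M.mulVec c) + 2 * ((θ - M.mulVec c) ⬝ᵥ ζ) + sqNorm ζ := by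
    intro c
    rw [← sqNorm_add]
    congr 1
    abel
  -- By AM–GM the cross term costs at most half of the error plus `2 t`.
  have hlow : ∀ m ∈ models p u, sqNorm (θ - M.mulVec (b m))
      ≤ 2 * (sqNorm (θ + ζ - M.mulVec (b m)) - sqNorm ζ) + 4 * t := by
    intro m hm
    have h1 := hζ m hm (b m) (hb m hm).1
    rw [hres]
    have h0 := sqNorm_nonneg (θ - M.mulVec (b m))
    set D := sqNorm (θ - M.mulVec (b m))
    have h2 : |(θ - M.mulVec (b m)) ⬝ᵥ ζ| ≤ t + D / 4 := by
      apply abs_le_of_sq_le_sq _ (by positivity)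
      nlinarith [sq_nonneg (t - D / 4)]
    have h3 := neg_abs_le ((θ - M.mulVec (b m)) ⬝ᵥ ζ)
    linarith
  have hup : sqNorm (θ + ζ - M.mulVec (b m₀)) - sqNorm ζ ≤ 2 * sqNorm (θ - M.mulVec c₀) + t := by
    have h1 := hζ m₀ hm₀ c₀ hc₀
    have h2 := (hb m₀ hm₀).2 c₀ hc₀
    rw [hres c₀] at h2
    have h0 := sqNorm_nonneg (θ - M.mulVec c₀)
    set D := sqNorm (θ - M.mulVec c₀)
    have h2 : |(θ - M.mulVec c₀) ⬝ᵥ ζ| ≤ (t + D) / 2 := by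
      apply abs_le_of_sq_le_sq _ (by positivity)
      nlinarith [sq_nonneg (t - D)]
    have h3 := le_abs_self ((θ - M.mulVec c₀) ⬝ᵥ ζ)
    linarith
  have hconv : sqNorm (θ - M.mulVec (betaEW α u M (θ + ζ) b))
      ≤ ∑ m ∈ models p u, w m * sqNorm (θ - M.mulVec (b m)) := by
    have h1 : θ - M.mulVec (betaEW α u M (θ + ζ) b)
        = ∑ m ∈ models p u, w m • (θ - M.mulVec (b m)) := by
      rw [betaEW, Matrix.mulVec_sum]
      simp only [smul_sub, Finset.sum_sub_distrib, ← Finset.sum_smul, hsum, one_smul,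
        Matrix.mulVec_smul]
      rfl
    rw [h1]
    exact sqNorm_sum_smul_le _ (fun m _ => hw0 m) hsum
  have hgibbs := sum_softmax_mul_le (s := models p u)
    (fun m => sqNorm (θ + ζ - M.mulVec (b m))) hα hm₀
  change ∑ m ∈ models p u, w m * sqNorm (θ + ζ - M.mulVec (b m)) ≤ _ at hgibbs
  calc sqNorm (θ - M.mulVec (betaEW α u M (θ + ζ) b))
      ≤ ∑ m ∈ models p u, w m * sqNorm (θ - M.mulVec (b m)) := hconv
    _ ≤ ∑ m ∈ models p u,
          w m * (2 * (sqNorm (θ + ζ - M.mulVec (b m)) - sqNorm ζ) + 4 * t) :=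
        Finset.sum_le_sum fun m hm => mul_le_mul_of_nonneg_left (hlow m hm) (hw0 m)
    _ = 2 * ∑ m ∈ models p u, w m * sqNorm (θ + ζ - M.mulVec (b m))
          + (4 * t - 2 * sqNorm ζ) * ∑ m ∈ models p u, w m := by
        rw [Finset.mul_sum, Finset.mul_sum, ← Finset.sum_add_distrib]
        exact Finset.sum_congr rfl fun m _ => by ring
    _ ≤ _ := by
        rw [hsum]
        linarith

/-- Without covariates, the exponentially weighted estimator vanishes. -/
theorem betaEW_zero (α : ℝ) (M : Matrix ι (Fin p) ℝ) (y : ι → ℝ)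
    (b : Finset (Fin p) → Fin p → ℝ) (hb : ∀ m ∈ models p 0, IsLeastSquares M y m (b m)) :
    betaEW α 0 M y b = 0 := by
  rw [betaEW]
  refine Finset.sum_eq_zero fun m hm => ?_
  have hm' : m = ∅ := by simpa [models] using hm
  have : b m = 0 := funext fun j => (hb m hm).1 j (by simp [hm'])
  rw [this, smul_zero]

/-- The coefficients of the projection of `μ` on the column span serve as comparison vector in the
oracle inequality. -/
theorem exists_sqNorm_sub_mulVec_eq_modelBias {n p : ℕ} (X : Matrix (Fin n) (Fin p) ℝ)
    (m : Finset (Fin p)) (μ : Fin n → ℝ) :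
    ∃ c : Fin p → ℝ, (∀ j, j ∉ m → c j = 0) ∧ sqNorm (μ - X.mulVec c) = modelBias X m μ := by
  have hmem : (colSpan X m).starProjection (WithLp.toLp 2 μ) ∈ colSpan X m :=
    Submodule.starProjection_apply_mem _ _
  rw [colSpan, Submodule.mem_span_image_finset_iff_exists_fun'] at hmem
  obtain ⟨c, hc⟩ := hmem
  refine ⟨fun j => if j ∈ m then c j else 0, fun j hj => by simp [hj], ?_⟩
  rw [modelBias, Submodule.starProjection_orthogonal, sub_apply,
    ContinuousLinearMap.id_apply, colSpan, ← hc, sqNorm_eq_norm_sq]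
  congr 2
  ext i
  simp [Matrix.mulVec, dotProduct, mul_comm]

/-- Bessel's inequality: `‖x - QᵀQx‖² = ‖x‖² - ‖Qx‖²`. -/
theorem sqNorm_mulVec_le_of_mul_transpose_eq_one {ι κ : Type*} [Fintype ι] [Fintype κ]
    [DecidableEq ι] {Q : Matrix ι κ ℝ} (hQ : Q * Q.transpose = 1) (x : κ → ℝ) :
    sqNorm (Q.mulVec x) ≤ sqNorm x := by
  have h0 := sqNorm_nonneg (x - Q.transpose.mulVec (Q.mulVec x))
  have h1 : (Q.transpose.mulVec (Q.mulVec x)) ⬝ᵥ (Q.transpose.mulVec (Q.mulVec x))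
      = Q.mulVec x ⬝ᵥ Q.mulVec x := by
    rw [Matrix.dotProduct_mulVec, Matrix.vecMul_transpose, Matrix.mulVec_mulVec, hQ,
      Matrix.one_mulVec]
  have h2 : x ⬝ᵥ (Q.transpose.mulVec (Q.mulVec x)) = Q.mulVec x ⬝ᵥ Q.mulVec x := by
    rw [Matrix.dotProduct_mulVec, Matrix.vecMul_transpose]
  have h3 : (Q.transpose.mulVec (Q.mulVec x)) ⬝ᵥ x = Q.mulVec x ⬝ᵥ Q.mulVec x := by
    rw [dotProduct_comm, h2]
  simp only [sqNorm_eq_dotProduct, sub_dotProduct, dotProduct_sub, h1, h2, h3] at h0 ⊢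
  linarith

end Deterministic

/-! ### Conditioning on a random design independent of the noise. -/

section Conditioning

variable {Ω 𝓓 𝓔 : Type*} [MeasurableSpace Ω] [MeasurableSpace 𝓓] [MeasurableSpace 𝓔]
  {P : Measure Ω} [IsProbabilityMeasure P] {ρ : Measure 𝓔} {D : Ω → 𝓓} {e : Ω → 𝓔}

theorem measure_prodMk_mem_eq_lintegral (hD : Measurable D) (he : HasLaw e ρ P)
    (h : IndepFun D e P) {S : Set (𝓓 × 𝓔)} (hS : MeasurableSet S) :
    P {ω | (D ω, e ω) ∈ S} = ∫⁻ ω, ρ {x | (D ω, x) ∈ S} ∂P := by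
  have hρ : IsProbabilityMeasure ρ := he.map_eq ▸ Measure.isProbabilityMeasure_map he.aemeasurable
  have hmap := h.map_prod_eq_prod_map_map hD.aemeasurable he.aemeasurable
  change P ((fun ω => (D ω, e ω)) ⁻¹' S) = _
  rw [← Measure.map_apply_of_aemeasurable (hD.aemeasurable.prodMk he.aemeasurable) hS, hmap,
    he.map_eq, Measure.prod_apply hS, lintegral_map (measurable_measure_prodMk_left hS) hD]
  rfl

theorem measure_prodMk_mem_le (hD : Measurable D) (he : HasLaw e ρ P)
    (h : IndepFun D e P) {S : Set (𝓓 × 𝓔)} (hS : MeasurableSet S) {c : ENNReal}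
    (hc : ∀ᵐ ω ∂P, ρ {x | (D ω, x) ∈ S} ≤ c) :
    P {ω | (D ω, e ω) ∈ S} ≤ c := by
  rw [measure_prodMk_mem_eq_lintegral hD he h hS]
  refine (lintegral_mono_ae hc).trans ?_
  simp

/-- A conditional law that does not depend on the realized design is also the unconditional law. -/
theorem hasLaw_of_ae_map_eq {𝓕 : Type*} [MeasurableSpace 𝓕] {π : Measure 𝓕}
    (hD : Measurable D) (he : HasLaw e ρ P) (h : IndepFun D e P) {T : 𝓓 → 𝓔 → 𝓕}
    (hT : Measurable (Function.uncurry T)) (hπ : ∀ᵐ ω ∂P, ρ.map (T (D ω)) = π) :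
    HasLaw (fun ω => T (D ω) (e ω)) π P := by
  have hm : AEMeasurable (fun ω => T (D ω) (e ω)) P :=
    hT.comp_aemeasurable (hD.aemeasurable.prodMk he.aemeasurable)
  refine ⟨hm, ?_⟩
  ext s hs
  rw [Measure.map_apply_of_aemeasurable hm hs]
  have h1 := measure_prodMk_mem_eq_lintegral hD he h (hT hs)
  refine h1.trans ?_
  have h2 : ∀ᵐ ω ∂P, ρ {x | (D ω, x) ∈ Function.uncurry T ⁻¹' s} = π s := by
    filter_upwards [hπ] with ω hω
    have hTω : Measurable (T (D ω)) := hT.comp measurable_prodMk_left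
    rw [← hω, Measure.map_apply hTω hs]
    rfl
  rw [lintegral_congr_ae h2]
  simp

end Conditioning

/-! ### Gaussian vectors in coordinates: F law, tightness, correlation with model errors. -/

section GaussianVectors

theorem map_mulVec_stdGaussian {ι κ : Type*} [Fintype ι] [Fintype κ] [DecidableEq ι]
    [DecidableEq κ] {Q : Matrix ι κ ℝ} (hQ : Q * Q.transpose = 1) :
    (stdGaussian (EuclideanSpace ℝ κ)).map (fun x => Q.mulVec x.ofLp)
      = Measure.pi fun _ : ι => gaussianReal 0 1 := by
  set L : EuclideanSpace ℝ κ →L[ℝ] EuclideanSpace ℝ ι :=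
    LinearMap.toContinuousLinearMap (Matrix.toLpLin 2 2 Q)
  set L' : EuclideanSpace ℝ ι →L[ℝ] EuclideanSpace ℝ κ :=
    LinearMap.toContinuousLinearMap (Matrix.toLpLin 2 2 Q.transpose)
  have hadj : L' = ContinuousLinearMap.adjoint L := by
    rw [ContinuousLinearMap.eq_adjoint_iff]
    intro x y
    simp only [L, L', LinearMap.coe_toContinuousLinearMap', Matrix.toLpLin_apply,
      EuclideanSpace.inner_eq_star_dotProduct, star_trivial]
    rw [Matrix.dotProduct_mulVec, Matrix.vecMul_transpose, dotProduct_comm]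
  have hL : L ∘L ContinuousLinearMap.adjoint L = ContinuousLinearMap.id ℝ _ := by
    rw [← hadj]
    ext x i
    simp [L, L', Matrix.toLpLin_apply, Matrix.mulVec_mulVec, hQ]
  have h := map_stdGaussian_of_comp_adjoint_eq_id L hL
  rw [← map_pi_eq_stdGaussian (ι := ι)] at h
  have h2 := congrArg (Measure.map (WithLp.ofLp (p := 2) (V := ι → ℝ))) h
  rw [Measure.map_map (by fun_prop) (by fun_prop), Measure.map_map (by fun_prop) (by fun_prop)]
    at h2
  simpa only [Function.comp_def, L, LinearMap.coe_toContinuousLinearMap', Matrix.toLpLin_apply,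
    Measure.map_id'] using h2

theorem hasLaw_chiSquared_prod {Ω : Type*} [MeasurableSpace Ω] {P : Measure Ω} {a b : ℕ}
    {ξ : Ω → Fin a ⊕ Fin b → ℝ} (hξ : HasLaw ξ (Measure.pi fun _ => gaussianReal 0 1) P) :
    HasLaw (fun ω => (sqNorm fun i => ξ ω (Sum.inl i), sqNorm fun i => ξ ω (Sum.inr i)))
      ((chiSquared a).prod (chiSquared b)) P := by
  have h1 := measurePreserving_sumPiEquivProdPi
    (fun _ : Fin a ⊕ Fin b => gaussianReal 0 1)
  have h2 := h1.comp_hasLaw hξ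
  have hf : ∀ d : ℕ, Measurable fun x : Fin d → ℝ => ∑ i, x i ^ 2 := fun d => by fun_prop
  have h3 : HasLaw (Prod.map (fun x : Fin a → ℝ => ∑ i, x i ^ 2)
      (fun x : Fin b → ℝ => ∑ i, x i ^ 2)) ((chiSquared a).prod (chiSquared b))
      ((Measure.pi fun _ : Fin a => gaussianReal 0 1).prod
        (Measure.pi fun _ : Fin b => gaussianReal 0 1)) :=
    ⟨((hf a).prodMap (hf b)).aemeasurable, by
      rw [← Measure.map_prod_map _ _ (hf a) (hf b)]; rfl⟩
  exact h3.comp h2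

theorem hasLaw_fDistribution {Ω : Type*} [MeasurableSpace Ω] {P : Measure Ω} {a b : ℕ}
    {ξ : Ω → Fin a ⊕ Fin b → ℝ} (hξ : HasLaw ξ (Measure.pi fun _ => gaussianReal 0 1) P) :
    HasLaw (fun ω => (sqNorm (fun i => ξ ω (Sum.inl i)) / a) /
      (sqNorm (fun i => ξ ω (Sum.inr i)) / b)) (fDistribution a b) P := by
  have hg : Measurable fun z : ℝ × ℝ => (z.1 / a) / (z.2 / b) := by fun_prop
  have h : HasLaw (fun z : ℝ × ℝ => (z.1 / a) / (z.2 / b)) (fDistribution a b)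
      ((chiSquared a).prod (chiSquared b)) := ⟨hg.aemeasurable, rfl⟩
  exact h.comp (hasLaw_chiSquared_prod hξ)

theorem hasLaw_toLp_stdGaussian {Ω : Type*} [MeasurableSpace Ω] {P : Measure Ω} {ι : Type*}
    [Fintype ι] {ξ : Ω → ι → ℝ} (hξ : HasLaw ξ (Measure.pi fun _ => gaussianReal 0 1) P) :
    HasLaw (fun ω => WithLp.toLp 2 (ξ ω)) (stdGaussian (EuclideanSpace ℝ ι)) P := by
  have h : HasLaw (WithLp.toLp 2) (stdGaussian (EuclideanSpace ℝ ι))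
      (Measure.pi fun _ : ι => gaussianReal 0 1) :=
    ⟨by fun_prop, map_pi_eq_stdGaussian⟩
  exact h.comp hξ

/-- The base of the Chernoff bound is made smaller than `min r 1`; its `d`-th power is then at most
`r` for every `d ≥ 1`. The upper tail below is treated likewise. -/
theorem exists_forall_measure_sqNorm_le_le {r : ℝ} (hr : 0 < r) :
    ∃ κ : ℝ, 0 < κ ∧ ∀ {Ω : Type*} [MeasurableSpace Ω] {P : Measure Ω} {d : ℕ}
      {ξ : Ω → Fin d → ℝ}, 0 < d → HasLaw ξ (Measure.pi fun _ => gaussianReal 0 1) P →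
      P {ω | sqNorm (ξ ω) ≤ κ * d} ≤ ENNReal.ofReal r := by
  have hlim : Tendsto (fun c : ℝ => Real.exp (1 / 2) * (√(1 + 1 / c))⁻¹) (𝓝[>] 0)
      (𝓝 (Real.exp (1 / 2) * 0)) := by
    refine Tendsto.const_mul _ (tendsto_inv_atTop_zero.comp ?_)
    refine Real.tendsto_sqrt_atTop.comp (tendsto_atTop_add_const_left _ _ ?_)
    exact (tendsto_inv_nhdsGT_zero (𝕜 := ℝ)).congr fun x => (one_div x).symm
  rw [mul_zero] at hlim
  have hev := hlim.eventually (gt_mem_nhds (lt_min hr one_pos))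
  obtain ⟨κ, hκ, hκ0⟩ := (hev.and self_mem_nhdsWithin).exists
  refine ⟨κ, hκ0, fun {Ω} _ {P d ξ} hd hξ => ?_⟩
  have h1 := (hasLaw_toLp_stdGaussian hξ).measure_eq (p := fun x => ‖x‖ ^ 2 ≤ κ * d)
    (measurableSet_le (by fun_prop) measurable_const)
  simp only [← sqNorm_eq_norm_sq] at h1
  rw [h1, ← ENNReal.ofReal_toReal (measure_ne_top (stdGaussian (EuclideanSpace ℝ (Fin d))) _)]
  refine ENNReal.ofReal_le_ofReal ?_
  have h2 := stdGaussian_normSq_le_le (E := EuclideanSpace ℝ (Fin d)) hκ0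
  rw [finrank_euclideanSpace_fin] at h2
  refine h2.trans ((pow_le_of_le_one (by positivity) ?_ hd.ne').trans ?_)
  · exact hκ.le.trans (min_le_right _ _)
  · exact hκ.le.trans (min_le_left _ _)

theorem exists_forall_measure_le_sqNorm_le {r : ℝ} (hr : 0 < r) :
    ∃ K : ℝ, 0 < K ∧ ∀ {Ω : Type*} [MeasurableSpace Ω] {P : Measure Ω} {d : ℕ}
      {ξ : Ω → Fin d → ℝ}, 0 < d → HasLaw ξ (Measure.pi fun _ => gaussianReal 0 1) P →
      P {ω | K * d ≤ sqNorm (ξ ω)} ≤ ENNReal.ofReal r := by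
  have hlim : Tendsto (fun c : ℝ => Real.exp (-(c / 4)) * √2) atTop (𝓝 (0 * √2)) :=
    (Real.tendsto_exp_neg_atTop_nhds_zero.comp
      (tendsto_id.atTop_div_const (by norm_num))).mul_const _
  rw [zero_mul] at hlim
  have hev := hlim.eventually (gt_mem_nhds (lt_min hr one_pos))
  obtain ⟨K, hK, hK0⟩ := (hev.and (eventually_gt_atTop 0)).exists
  refine ⟨K, hK0, fun {Ω} _ {P d ξ} hd hξ => ?_⟩
  have h1 := (hasLaw_toLp_stdGaussian hξ).measure_eq (p := fun x => K * d ≤ ‖x‖ ^ 2)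
    (measurableSet_le measurable_const (by fun_prop))
  simp only [← sqNorm_eq_norm_sq] at h1
  rw [h1, ← ENNReal.ofReal_toReal (measure_ne_top (stdGaussian (EuclideanSpace ℝ (Fin d))) _)]
  refine ENNReal.ofReal_le_ofReal ?_
  have h2 := stdGaussian_normSq_ge_le (E := EuclideanSpace ℝ (Fin d)) (K * d)
  rw [finrank_euclideanSpace_fin] at h2
  have h3 : Real.exp (-(K * d) / 4) * √2 ^ d = (Real.exp (-(K / 4)) * √2) ^ d := by
    rw [mul_pow, ← Real.exp_nat_mul]
    congr 2
    ring
  rw [h3] at h2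
  refine h2.trans ((pow_le_of_le_one (by positivity) ?_ hd.ne').trans ?_)
  · exact hK.le.trans (min_le_right _ _)
  · exact hK.le.trans (min_le_left _ _)

/-- The event that the noise is strongly correlated with the approximation error of some linear
combination of the columns of `X` in a model of size `u`. -/
def IsCorrelated {ι : Type*} [Fintype ι] {n p : ℕ} (t : ℝ) (u : ℕ) (Q : Matrix ι (Fin n) ℝ)
    (X : Matrix (Fin n) (Fin p) ℝ) (μ : Fin n → ℝ) (x : Fin n → ℝ) : Prop :=
  ∃ m ∈ models p u, ∃ c : Fin p → ℝ, (∀ j, j ∉ m → c j = 0) ∧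
    t * sqNorm (Q.mulVec μ - (Q * X).mulVec c)
      < ((Q.mulVec μ - (Q * X).mulVec c) ⬝ᵥ Q.mulVec x) ^ 2

/-- The least squares coefficients depend on the noise, so the bound has to be uniform in `c`. For
fixed `m` all errors lie in the span of `Qμ` and `u` columns of `QX`, whence the exponent `u + 1`.
-/
theorem stdGaussian_isCorrelated_le {ι : Type*} [Fintype ι] [DecidableEq ι] {n p : ℕ} (t : ℝ)
    (u : ℕ) {Q : Matrix ι (Fin n) ℝ} (hQ : Q * Q.transpose = 1) (X : Matrix (Fin n) (Fin p) ℝ)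
    (μ : Fin n → ℝ) :
    stdGaussian (EuclideanSpace ℝ (Fin n)) {x | IsCorrelated t u Q X μ x.ofLp}
      ≤ ENNReal.ofReal ((models p u).card * (Real.exp (-t / 4) * √2 ^ (u + 1))) := by
  classical
  -- `Qᵀ` is isometric and carries the products with `Qx` to inner products with `x` itself.
  let G : (Fin n → ℝ) → EuclideanSpace ℝ (Fin n) :=
    fun v => WithLp.toLp 2 (Q.transpose.mulVec (Q.mulVec v))
  let V : Finset (Fin p) → Finset (EuclideanSpace ℝ (Fin n)) :=
    fun m => insert (G μ) (m.image fun j => G fun i => X i j)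
  have hsub : {x : EuclideanSpace ℝ (Fin n) | IsCorrelated t u Q X μ x.ofLp}
      ⊆ ⋃ m ∈ models p u, {x | ∃ w ∈ Submodule.span ℝ (V m : Set (EuclideanSpace ℝ (Fin n))),
        t * ‖w‖ ^ 2 < (inner ℝ w x) ^ 2} := by
    rintro x ⟨m, hm, c, hc, h⟩
    rw [Set.mem_iUnion₂]
    set w := Q.mulVec μ - (Q * X).mulVec c with hw
    have hnorm : ‖WithLp.toLp 2 (Q.transpose.mulVec w)‖ ^ 2 = sqNorm w := by
      rw [← sqNorm_eq_norm_sq, sqNorm_eq_dotProduct, sqNorm_eq_dotProduct,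
        Matrix.dotProduct_mulVec, Matrix.vecMul_transpose, Matrix.mulVec_mulVec, hQ,
        Matrix.one_mulVec]
    have hinner : inner ℝ (WithLp.toLp 2 (Q.transpose.mulVec w)) x = w ⬝ᵥ Q.mulVec x.ofLp := by
      rw [EuclideanSpace.inner_eq_star_dotProduct, star_trivial, Matrix.dotProduct_mulVec,
        Matrix.vecMul_transpose, dotProduct_comm]
    refine ⟨m, hm, WithLp.toLp 2 (Q.transpose.mulVec w), ?_, ?_⟩
    · have hsum : WithLp.toLp 2 (Q.transpose.mulVec w)
          = G μ - ∑ j ∈ m, c j • G fun i => X i j := by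
        have hXc : X.mulVec c = ∑ j ∈ m, c j • (fun i => X i j) := by
          ext i
          simp only [Matrix.mulVec, dotProduct, Finset.sum_apply, Pi.smul_apply, smul_eq_mul]
          rw [← Finset.sum_subset (Finset.subset_univ m)
            (fun j _ hj => by rw [hc j hj, mul_zero])]
          exact Finset.sum_congr rfl fun j _ => mul_comm _ _
        rw [hw, ← Matrix.mulVec_mulVec, hXc]
        simp only [G, Matrix.mulVec_sub, Matrix.mulVec_sum, Matrix.mulVec_smul, WithLp.toLp_sub,
          WithLp.toLp_sum, WithLp.toLp_smul]
      rw [hsum]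
      refine Submodule.sub_mem _ (Submodule.subset_span (by simp [V])) ?_
      refine Submodule.sum_mem _ fun j hj => Submodule.smul_mem _ _ (Submodule.subset_span ?_)
      simp only [V, Finset.coe_insert, Finset.coe_image]
      exact Or.inr ⟨j, hj, rfl⟩
    · rw [hnorm, hinner]
      exact h
  have hcard : ∀ m ∈ models p u,
      Module.finrank ℝ (Submodule.span ℝ (V m : Set (EuclideanSpace ℝ (Fin n)))) ≤ u + 1 := by
    intro m hm
    refine (finrank_span_finset_le_card (V m)).trans ((Finset.card_insert_le _ _).trans ?_)
    have := (Finset.mem_powersetCard.mp hm).2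
    have := Finset.card_image_le (s := m) (f := fun j => G fun i => X i j)
    omega
  refine (measure_mono hsub).trans ((measure_biUnion_finset_le _ _).trans ?_)
  have hterm : ∀ m ∈ models p u, stdGaussian (EuclideanSpace ℝ (Fin n))
      {x | ∃ w ∈ Submodule.span ℝ (V m : Set (EuclideanSpace ℝ (Fin n))),
        t * ‖w‖ ^ 2 < (inner ℝ w x) ^ 2}
      ≤ ENNReal.ofReal (Real.exp (-t / 4) * √2 ^ (u + 1)) := by
    intro m hm
    refine (stdGaussian_exists_inner_sq_gt_le _).trans (ENNReal.ofReal_le_ofReal ?_)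
    refine mul_le_mul_of_nonneg_left ?_ (Real.exp_pos _).le
    exact pow_le_pow_right₀ (by rw [Real.one_le_sqrt]; norm_num) (hcard m hm)
  refine (Finset.sum_le_sum hterm).trans_eq ?_
  rw [Finset.sum_const, nsmul_eq_mul, ENNReal.ofReal_mul (Nat.cast_nonneg _),
    ENNReal.ofReal_natCast]

/-- Supplies measurability despite the uncountable union over `c`: for fixed `m` and `c` the
condition is a strict inequality between continuous functions. -/
theorem isOpen_setOf_isCorrelated {n p na nb : ℕ} (t : ℝ) (u : ℕ) :
    IsOpen {z : ((Fin n → Fin p → ℝ) × (Fin n → ℝ) × (Fin na → Fin n → ℝ) × (Fin nb → Fin n → ℝ)) ×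
        EuclideanSpace ℝ (Fin n) |
      IsCorrelated t u (Matrix.fromRows (Matrix.of z.1.2.2.1) (Matrix.of z.1.2.2.2))
        (Matrix.of z.1.1) z.1.2.1 z.2.ofLp} := by
  simp only [IsCorrelated, Set.ofPred_exists, Set.ofPred_and]
  refine isOpen_iUnion fun m => IsOpen.inter isOpen_const ?_
  refine isOpen_iUnion fun c => IsOpen.inter isOpen_const ?_
  simp only [sqNorm, dotProduct, Matrix.mulVec, Matrix.mul_apply, Pi.sub_apply,
    Fintype.sum_sum_type, Matrix.fromRows_apply_inl, Matrix.fromRows_apply_inr, Matrix.of_apply]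
  exact isOpen_lt (by fun_prop) (by fun_prop)

end GaussianVectors

/-! ### Calculus of convergence in probability. -/

section LittleO

variable {Ω : ℕ → Type*} [∀ n, MeasurableSpace (Ω n)] {P : ∀ n, Measure (Ω n)}

theorem IsLittleOP.congr {V V' : ∀ n, Ω n → ℝ} (h : IsLittleOP P V)
    (hV : ∀ n, V n =ᵐ[P n] V' n) : IsLittleOP P V' := by
  intro δ hδ
  refine (h δ hδ).congr fun n => measure_congr ?_
  filter_upwards [hV n] with ω hω
  exact congrArg (fun z => δ ≤ |z|) hω

theorem IsLittleOP.const_mul {V : ∀ n, Ω n → ℝ} (h : IsLittleOP P V) {c : ℝ} (hc : 0 < c) :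
    IsLittleOP P fun n ω => c * V n ω := by
  intro δ hδ
  refine (h (δ / c) (by positivity)).congr fun n => ?_
  simp only [abs_mul, abs_of_pos hc, div_le_iff₀' hc]

end LittleO

/-! ### Stability of ratios of mean squares. -/

section Perturbation

/-- Uniform continuity of the quotient on `[0, K] × [κ, ∞)`; `δ ≤ κ / 2` keeps `D'` above `κ / 2`.
-/
theorem exists_forall_abs_div_sub_div_lt {K κ η : ℝ} (hK : 0 < K) (hκ : 0 < κ) (hη : 0 < η) :
    ∃ δ : ℝ, 0 < δ ∧ ∀ N D N' D' : ℝ, 0 ≤ N → N ≤ K → κ ≤ D → |N' - N| ≤ δ → |D' - D| ≤ δ →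
      |N' / D' - N / D| < η := by
  obtain ⟨δ, hδ0, h1, h2⟩ : ∃ δ : ℝ, 0 < δ ∧ δ ≤ κ / 2 ∧ δ * (κ + K) < η * (κ / 2 * κ) := by
    refine ⟨min (κ / 2) (η * (κ / 2 * κ) / (2 * (κ + K))), by positivity, min_le_left _ _, ?_⟩
    have h := min_le_right (κ / 2) (η * (κ / 2 * κ) / (2 * (κ + K)))
    calc _ ≤ η * (κ / 2 * κ) / (2 * (κ + K)) * (κ + K) :=
          mul_le_mul_of_nonneg_right h (by positivity)
      _ = η * (κ / 2 * κ) / 2 := by field_simp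
      _ < _ := half_lt_self (by positivity)
  refine ⟨δ, hδ0, fun N D N' D' hN hNK hD hN' hD' => ?_⟩
  have hD0 : 0 < D := hκ.trans_le hD
  have hD'κ : κ / 2 ≤ D' := by linarith [(abs_le.mp hD').1]
  have hD'0 : 0 < D' := by linarith
  have heq : N' / D' - N / D = ((N' - N) * D - N * (D' - D)) / (D' * D) := by
    field_simp
    ring
  rw [heq, abs_div, abs_of_pos (mul_pos hD'0 hD0), div_lt_iff₀ (mul_pos hD'0 hD0)]
  have h3 : |(N' - N) * D - N * (D' - D)| ≤ δ * D + K * δ := by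
    refine (abs_sub _ _).trans ?_
    rw [abs_mul, abs_mul, abs_of_pos hD0, abs_of_nonneg hN]
    gcongr
  have h4 : κ * (δ * D + K * δ) ≤ δ * (κ + K) * D := by nlinarith [mul_pos hK hδ0]
  have h5 : δ * (κ + K) * D < η * (κ / 2 * κ) * D := mul_lt_mul_of_pos_right h2 hD0
  have h6 : η * (κ / 2 * κ) * D ≤ κ * (η * (D' * D)) := by
    have := mul_le_mul_of_nonneg_right hD'κ (by positivity : 0 ≤ η * κ * D)
    linarith
  have h7 : κ * (δ * D + K * δ) < κ * (η * (D' * D)) := by linarith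
  exact h3.trans_lt (lt_of_mul_lt_mul_left h7 hκ.le)

theorem abs_two_mul_dotProduct_le {ι : Type*} [Fintype ι] {l : ℝ} (hl : 0 < l) (x d : ι → ℝ) :
    |2 * (x ⬝ᵥ d)| ≤ l * sqNorm x + sqNorm d / l := by
  have h1 := sqNorm_nonneg (l • x + d)
  have h2 := sqNorm_nonneg (l • x + (-1 : ℝ) • d)
  rw [sqNorm_add, sqNorm_smul, smul_dotProduct, smul_eq_mul] at h1 h2
  rw [dotProduct_smul, smul_eq_mul, sqNorm_smul] at h2
  have h3 : l * (l * sqNorm x + sqNorm d / l) = l ^ 2 * sqNorm x + sqNorm d := by field_simp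
  rw [abs_le]
  constructor <;> refine le_of_mul_le_mul_left ?_ hl
  · rw [mul_neg, h3]; linarith
  · rw [h3]; linarith

theorem exists_forall_abs_sqNorm_add_div_sub_le {K δ : ℝ} (hK : 0 < K) (hδ : 0 < δ) :
    ∃ δ' : ℝ, 0 < δ' ∧ ∀ {ι : Type*} [Fintype ι] (x d : ι → ℝ) (a : ℝ), 0 < a →
      sqNorm x ≤ K * a → sqNorm d ≤ δ' * a → |sqNorm (x + d) / a - sqNorm x / a| ≤ δ := by
  -- The weight `l` splits the cross term: `l ‖x‖²` takes `δ / 2`, while `‖d‖² / l` and `‖d‖²` take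
  -- `δ / 4` each.
  obtain ⟨l, hl0, hl1, hlK⟩ : ∃ l : ℝ, 0 < l ∧ l ≤ 1 ∧ l * K ≤ δ / 2 := by
    refine ⟨min 1 (δ / 2 / K), by positivity, min_le_left _ _, ?_⟩
    calc _ ≤ δ / 2 / K * K := mul_le_mul_of_nonneg_right (min_le_right _ _) hK.le
      _ = δ / 2 := by field_simp
  refine ⟨l * δ / 4, by positivity, fun {ι} _ x d a ha hx hd => ?_⟩
  have h1 := abs_two_mul_dotProduct_le hl0 x d
  have h2 : sqNorm d / l ≤ δ / 4 * a := by
    rw [div_le_iff₀ hl0]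
    linarith
  have h3 : sqNorm d ≤ δ / 4 * a := by
    refine hd.trans (mul_le_mul_of_nonneg_right ?_ ha.le)
    nlinarith
  have h4 : l * sqNorm x ≤ δ / 2 * a := by
    calc l * sqNorm x ≤ l * (K * a) := mul_le_mul_of_nonneg_left hx hl0.le
      _ = l * K * a := by ring
      _ ≤ _ := mul_le_mul_of_nonneg_right hlK ha.le
  rw [← sub_div, sqNorm_add, abs_div, abs_of_pos ha, div_le_iff₀ ha]
  have h0 := sqNorm_nonneg d
  calc |sqNorm x + 2 * (x ⬝ᵥ d) + sqNorm d - sqNorm x| = |2 * (x ⬝ᵥ d) + sqNorm d| := by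
        congr 1; ring
    _ ≤ |2 * (x ⬝ᵥ d)| + |sqNorm d| := abs_add_le _ _
    _ ≤ δ * a := by rw [abs_of_nonneg h0]; linarith

variable {Ω : ℕ → Type*} [∀ n, MeasurableSpace (Ω n)] {P : ∀ n, Measure (Ω n)}

/-- The ratio of the mean squares of two standard Gaussian vectors is stable under perturbations of
the vectors that are of smaller order than their dimensions. -/
theorem isLittleOP_meanSquare_ratio {na nb : ℕ → ℕ}
    (hnab : ∀ᶠ n in atTop, 0 < na n ∧ 0 < nb n)
    {x d : ∀ n, Ω n → Fin (na n) → ℝ} {y d' : ∀ n, Ω n → Fin (nb n) → ℝ}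
    (hx : ∀ n, HasLaw (x n) (Measure.pi fun _ => gaussianReal 0 1) (P n))
    (hy : ∀ n, HasLaw (y n) (Measure.pi fun _ => gaussianReal 0 1) (P n))
    (hd : IsLittleOP P fun n ω =>
      (sqNorm (d n ω) + sqNorm (d' n ω)) / ((min (na n) (nb n) : ℕ) : ℝ)) :
    IsLittleOP P fun n ω => (sqNorm (x n ω + d n ω) / na n) / (sqNorm (y n ω + d' n ω) / nb n)
      - (sqNorm (x n ω) / na n) / (sqNorm (y n ω) / nb n) := by
  intro η hη
  rw [ENNReal.tendsto_nhds_zero]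
  intro ρ hρ
  -- There are four exceptional events: `x` or `y` too large, `y` too small, the shift too large.
  obtain ⟨r, hr0, hr⟩ : ∃ r : ℝ, 0 < r ∧ 4 * ENNReal.ofReal r ≤ ρ := by
    obtain ⟨q, hq0, hq⟩ := ENNReal.lt_iff_exists_real_btwn.mp hρ
    have hq1 : 0 < q := by simpa using hq.1
    refine ⟨q / 4, by positivity, le_of_eq_of_le ?_ hq.2.le⟩
    rw [← ENNReal.ofReal_ofNat 4, ← ENNReal.ofReal_mul (by norm_num)]
    congr 1
    ring
  obtain ⟨κ, hκ, hlow⟩ := exists_forall_measure_sqNorm_le_le hr0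
  obtain ⟨K, hK, hup⟩ := exists_forall_measure_le_sqNorm_le hr0
  obtain ⟨δ, hδ, hdiv⟩ := exists_forall_abs_div_sub_div_lt hK hκ hη
  obtain ⟨δ', hδ', hsq⟩ := exists_forall_abs_sqNorm_add_div_sub_le hK hδ
  have hdlim := hd δ' hδ'
  rw [ENNReal.tendsto_nhds_zero] at hdlim
  filter_upwards [hnab, hdlim (ENNReal.ofReal r) (by simpa using hr0)] with n hn hdn
  have ha : (0 : ℝ) < na n := by exact_mod_cast hn.1
  have hb : (0 : ℝ) < nb n := by exact_mod_cast hn.2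
  have hk : (0 : ℝ) < ((min (na n) (nb n) : ℕ) : ℝ) := by exact_mod_cast lt_min hn.1 hn.2
  have hka : ((min (na n) (nb n) : ℕ) : ℝ) ≤ na n := by exact_mod_cast min_le_left _ _
  have hkb : ((min (na n) (nb n) : ℕ) : ℝ) ≤ nb n := by exact_mod_cast min_le_right _ _
  refine (measure_mono (t := ({ω | K * na n ≤ sqNorm (x n ω)} ∪ {ω | K * nb n ≤ sqNorm (y n ω)}) ∪
    ({ω | sqNorm (y n ω) ≤ κ * nb n} ∪
      {ω | δ' ≤ |(sqNorm (d n ω) + sqNorm (d' n ω)) / ((min (na n) (nb n) : ℕ) : ℝ)|}))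
    fun ω hω => ?_).trans ?_
  · by_contra hcon
    simp only [Set.mem_union, Set.mem_ofPred_eq, not_or, not_le] at hcon hω
    obtain ⟨⟨h1, h2⟩, h3, h4⟩ := hcon
    have hd0 := sqNorm_nonneg (d n ω)
    have hd'0 := sqNorm_nonneg (d' n ω)
    rw [abs_of_nonneg (by positivity), div_lt_iff₀ hk] at h4
    have h5 := mul_le_mul_of_nonneg_left hka hδ'.le
    have h6 := mul_le_mul_of_nonneg_left hkb hδ'.le
    have hN := hsq (x n ω) (d n ω) (na n) ha h1.le (by linarith)
    have hD := hsq (y n ω) (d' n ω) (nb n) hb h2.le (by linarith)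
    have := hdiv _ _ _ _ (div_nonneg (sqNorm_nonneg (x n ω)) ha.le)
      ((div_le_iff₀ ha).mpr h1.le) ((le_div_iff₀ hb).mpr h3.le) hN hD
    linarith
  · refine (measure_union_le _ _).trans (le_trans ?_ hr)
    refine (add_le_add ((measure_union_le _ _).trans (add_le_add (hup hn.1 (hx n))
      (hup hn.2 (hy n)))) ((measure_union_le _ _).trans (add_le_add (hlow hn.2 (hy n))
        hdn))).trans_eq ?_
    ring

end Perturbation

/-! ### Prediction error and union bound at a fixed sample size. -/

section Consistency

theorem modelBias_nonneg {n p : ℕ} (X : Matrix (Fin n) (Fin p) ℝ) (m : Finset (Fin p))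
    (μ : Fin n → ℝ) : 0 ≤ modelBias X m μ := sq_nonneg _

/-- The prediction error of exponential weighting, for noise `σ x` that is not strongly correlated
with the approximation errors. -/
theorem sqNorm_mulVec_sub_mulVec_betaEW_le {ι : Type*} [Fintype ι] [DecidableEq ι] {n p s u : ℕ}
    {α σ t : ℝ} (hα : 0 < α) (ht : 0 ≤ t) {Q : Matrix ι (Fin n) ℝ} (hQ : Q * Q.transpose = 1)
    (X : Matrix (Fin n) (Fin p) ℝ) (μ x : Fin n → ℝ) {y : ι → ℝ}
    (hy : y = Q.mulVec μ + σ • Q.mulVec x) (b : Finset (Fin p) → Fin p → ℝ)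
    (hb : ∀ m ∈ models p u, IsLeastSquares (Q * X) y m (b m))
    (hx : ¬ IsCorrelated t u Q X μ x) {S : Finset (Fin p)} (hS : S ∈ models p s) (hsu : s ≤ u)
    (hup : u ≤ p) :
    sqNorm (Q.mulVec μ - (Q * X).mulVec (betaEW α u (Q * X) y b))
      ≤ 4 * modelBias X S μ + 6 * (σ ^ 2 * t) + 2 * (α * Real.log (models p u).card) := by
  subst hy
  have hScard : S.card = s := (Finset.mem_powersetCard.mp hS).2
  -- The sparse set is enlarged to a model of size exactly `u`, over which the weights run.
  obtain ⟨m₀, hSm₀, -, hm₀⟩ := Finset.exists_subsuperset_card_eq (Finset.subset_univ S)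
    (hScard.trans_le hsu) (by simpa using hup)
  have hm₀' : m₀ ∈ models p u := Finset.mem_powersetCard.mpr ⟨Finset.subset_univ _, hm₀⟩
  obtain ⟨c₀, hc₀, hbias⟩ := exists_sqNorm_sub_mulVec_eq_modelBias X S μ
  have h := sqNorm_sub_mulVec_betaEW_le (t := σ ^ 2 * t) hα (by positivity) (Q * X) (Q.mulVec μ)
    (σ • Q.mulVec x) b hb ?_ hm₀' (c₀ := c₀) (fun j hj => hc₀ j fun hjS => hj (hSm₀ hjS))
  · have h1 : sqNorm (Q.mulVec μ - (Q * X).mulVec c₀) ≤ modelBias X S μ := by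
      rw [← hbias, ← Matrix.mulVec_mulVec, ← Matrix.mulVec_sub]
      exact sqNorm_mulVec_le_of_mul_transpose_eq_one hQ _
    linarith
  · intro m hm c hc
    rw [IsCorrelated] at hx
    push Not at hx
    have h1 := hx m hm c hc
    rw [dotProduct_smul, smul_eq_mul, mul_pow, mul_assoc]
    exact mul_le_mul_of_nonneg_left h1 (sq_nonneg σ)

theorem sqNorm_mulVec_sub_mulVec_betaEW_zero_le {ι : Type*} [Fintype ι] [DecidableEq ι] {n p : ℕ}
    (α : ℝ) {Q : Matrix ι (Fin n) ℝ} (hQ : Q * Q.transpose = 1) (X : Matrix (Fin n) (Fin p) ℝ)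
    (μ : Fin n → ℝ) (y : ι → ℝ) (b : Finset (Fin p) → Fin p → ℝ)
    (hb : ∀ m ∈ models p 0, IsLeastSquares (Q * X) y m (b m)) {S : Finset (Fin p)}
    (hS : S ∈ models p 0) :
    sqNorm (Q.mulVec μ - (Q * X).mulVec (betaEW α 0 (Q * X) y b)) ≤ modelBias X S μ := by
  obtain ⟨c₀, hc₀, hbias⟩ := exists_sqNorm_sub_mulVec_eq_modelBias X S μ
  have hS' : S = ∅ := by simpa [models] using hS
  have hc : c₀ = 0 := funext fun j => hc₀ j (by simp [hS'])
  rw [betaEW_zero α _ _ b hb, ← hbias, hc, Matrix.mulVec_zero, Matrix.mulVec_zero, sub_zero,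
    sub_zero]
  exact sqNorm_mulVec_le_of_mul_transpose_eq_one hQ _

theorem card_models_le_pow (p u : ℕ) : ((models p u).card : ℝ) ≤ (p : ℝ) ^ u := by
  rw [models, Finset.card_powersetCard, Finset.card_univ, Fintype.card_fin]
  exact (Nat.choose_le_pow_div (α := ℝ) u p).trans
    (div_le_self (by positivity) (by exact_mod_cast Nat.one_le_iff_ne_zero.mpr u.factorial_ne_zero))

theorem log_card_models_le {p : ℕ} (hp : 0 < p) (u : ℕ) :
    Real.log (models p u).card ≤ u * Real.log p := by
  have hp' : (1 : ℝ) ≤ p := by exact_mod_cast hp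
  rcases Nat.eq_zero_or_pos (models p u).card with h | h
  · rw [h, Nat.cast_zero, Real.log_zero]
    exact mul_nonneg (Nat.cast_nonneg _) (Real.log_nonneg hp')
  · rw [← Real.log_pow]
    exact Real.log_le_log (by exact_mod_cast h) (card_models_le_pow p u)

theorem card_models_mul_exp_le {n p u : ℕ} {t : ℝ} (hn : 0 < n) (hnp : n < p) (hu : 0 < u)
    (ht : u * Real.log p ≤ t / 16) :
    (models p u).card * (Real.exp (-t / 4) * √2 ^ (u + 1)) ≤ 1 / n := by
  have hp0 : (0 : ℝ) < p := by exact_mod_cast hn.trans hnp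
  have hp2 : (2 : ℝ) ≤ p := by exact_mod_cast (by omega : 2 ≤ p)
  have hu1 : (1 : ℝ) ≤ u := by exact_mod_cast hu
  have hlog : 0 ≤ Real.log p := Real.log_nonneg (by linarith)
  have hpow : (p : ℝ) ^ u = Real.exp (u * Real.log p) := by
    rw [Real.exp_nat_mul, Real.exp_log hp0]
  have h2 : √2 ^ (u + 1) ≤ (p : ℝ) ^ u := by
    calc √2 ^ (u + 1) ≤ √2 ^ (2 * u) :=
          pow_le_pow_right₀ (by rw [Real.one_le_sqrt]; norm_num) (by omega)
      _ = 2 ^ u := by rw [pow_mul, Real.sq_sqrt (by norm_num)]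
      _ ≤ _ := pow_le_pow_left₀ (by norm_num) hp2 u
  calc (models p u).card * (Real.exp (-t / 4) * √2 ^ (u + 1))
      ≤ (p : ℝ) ^ u * (Real.exp (-t / 4) * (p : ℝ) ^ u) := by
        gcongr
        exact card_models_le_pow p u
    _ = Real.exp (u * Real.log p + (-t / 4 + u * Real.log p)) := by
        rw [hpow, ← Real.exp_add, ← Real.exp_add]
    _ ≤ Real.exp (-Real.log p) := by
        apply Real.exp_le_exp.mpr
        -- The two powers of `p ^ u` are beaten by `exp (-t / 4) ≤ p ^ (-4u)`, leaving `p ^ (-2u) ≤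
        -- 1 / p`.
        nlinarith
    _ = 1 / p := by rw [Real.exp_neg, Real.exp_log hp0, one_div]
    _ ≤ 1 / n := one_div_le_one_div_of_le (by exact_mod_cast hn) (by exact_mod_cast hnp.le)

end Consistency

/-! ### Prediction consistency along the sequence of models. -/

theorem fromRows_mul_transpose_eq_one {n na nb : ℕ} {A : Matrix (Fin na) (Fin n) ℝ}
    {B : Matrix (Fin nb) (Fin n) ℝ} (hA : A * A.transpose = 1) (hB : B * B.transpose = 1)
    (hAB : A * B.transpose = 0) :
    Matrix.fromRows A B * (Matrix.fromRows A B).transpose = 1 := by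
  have hBA : B * A.transpose = 0 := by
    rw [← Matrix.transpose_transpose B, ← Matrix.transpose_mul, hAB, Matrix.transpose_zero]
  rw [Matrix.transpose_fromRows, Matrix.fromRows_mul_fromCols, hA, hB, hAB, hBA,
    Matrix.fromBlocks_one]

theorem le_of_mul_transpose_eq_one {n na : ℕ} {A : Matrix (Fin na) (Fin n) ℝ}
    (hA : A * A.transpose = 1) : na ≤ n := by
  have h := (Matrix.rank_mul_le_left A A.transpose).trans A.rank_le_width
  rwa [hA, Matrix.rank_one, Fintype.card_fin] at h

/-- Consistency of exponential weighting for the prediction of a weakly sparse mean. -/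
theorem isLittleOP_sqNorm_mulVec_sub_mulVec_betaEW {Ω : ℕ → Type*} [∀ n, MeasurableSpace (Ω n)]
    {P : ∀ n, Measure (Ω n)} [∀ n, IsProbabilityMeasure (P n)] {p s u na nb : ℕ → ℕ}
    {X : ∀ n, Ω n → Fin n → Fin (p n) → ℝ} {μ : ∀ n, Ω n → Fin n → ℝ}
    {A : ∀ n, Ω n → Fin (na n) → Fin n → ℝ} {B : ∀ n, Ω n → Fin (nb n) → Fin n → ℝ}
    {x : ∀ n, Ω n → EuclideanSpace ℝ (Fin n)} {y : ∀ n, Ω n → Fin (na n) ⊕ Fin (nb n) → ℝ}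
    {σ : ℝ} (hσ : 0 < σ)
    (hD : ∀ n, Measurable fun ω => (X n ω, μ n ω, A n ω, B n ω))
    (hx : ∀ n, HasLaw (x n) (stdGaussian (EuclideanSpace ℝ (Fin n))) (P n))
    (hindep : ∀ n, IndepFun (fun ω => (X n ω, μ n ω, A n ω, B n ω)) (x n) (P n))
    (hQ : ∀ n, ∀ᵐ ω ∂(P n), Matrix.fromRows (Matrix.of (A n ω)) (Matrix.of (B n ω)) *
      (Matrix.fromRows (Matrix.of (A n ω)) (Matrix.of (B n ω))).transpose = 1)
    (hy : ∀ n, ∀ᵐ ω ∂(P n), y n ω =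
      (Matrix.fromRows (Matrix.of (A n ω)) (Matrix.of (B n ω))).mulVec (μ n ω) +
        σ • (Matrix.fromRows (Matrix.of (A n ω)) (Matrix.of (B n ω))).mulVec (x n ω).ofLp)
    (hnab : ∀ᶠ n in atTop, 0 < na n ∧ 0 < nb n) (hna : ∀ n, na n ≤ n)
    (hp : ∀ᶠ n in atTop, n < p n)
    (hsparse : WeaklySparse P (fun n ω => Matrix.of (X n ω)) μ s
      fun n => ((min (na n) (nb n) : ℕ) : ℝ))
    (hsu : ∀ᶠ n in atTop, s n ≤ u n)
    (hu : Tendsto (fun n => (u n : ℝ) * Real.log (p n) / ((min (na n) (nb n) : ℕ) : ℝ))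
      atTop (𝓝 0))
    {α : ℕ → ℝ} (hα : ∀ n, 0 < α n) (hαbdd : BddAbove (Set.range α))
    {b : ∀ n, Ω n → Finset (Fin (p n)) → Fin (p n) → ℝ}
    (hb : ∀ n ω, ∀ m ∈ models (p n) (u n), IsLeastSquares
      (Matrix.fromRows (Matrix.of (A n ω)) (Matrix.of (B n ω)) * Matrix.of (X n ω))
      (y n ω) m (b n ω m)) :
    IsLittleOP P fun n ω =>
      sqNorm ((Matrix.fromRows (Matrix.of (A n ω)) (Matrix.of (B n ω))).mulVec (μ n ω) -
        (Matrix.fromRows (Matrix.of (A n ω)) (Matrix.of (B n ω)) * Matrix.of (X n ω)).mulVec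
          (betaEW (α n) (u n)
            (Matrix.fromRows (Matrix.of (A n ω)) (Matrix.of (B n ω)) * Matrix.of (X n ω))
            (y n ω) (b n ω))) / ((min (na n) (nb n) : ℕ) : ℝ) := by
  intro Δ hΔ
  obtain ⟨S, hS, hbias⟩ := hsparse
  obtain ⟨C, hC⟩ := hαbdd
  have hαC : ∀ n, α n ≤ C := fun n => hC ⟨n, rfl⟩
  have hC0 : 0 < C := (hα 0).trans_le (hαC 0)
  have hbias0 := hbias (Δ / 16) (by positivity)
  have hlim : Tendsto (fun n : ℕ => ENNReal.ofReal (1 / n)) atTop (𝓝 0) := by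
    rw [← ENNReal.ofReal_zero]
    exact ENNReal.tendsto_ofReal tendsto_one_div_atTop_nhds_zero_nat
  have hbound := hbias0.add hlim
  rw [add_zero] at hbound
  refine tendsto_of_tendsto_of_tendsto_of_le_of_le' tendsto_const_nhds hbound
    (Eventually.of_forall fun _ => zero_le) ?_
  -- These thresholds give, in turn, `u ≤ p`, an entropy term of at most `Δ k / 4`, and `u log p ≤ t
  -- / 16` for the union bound.
  have hu1 := hu.eventually (gt_mem_nhds (Real.log_pos one_lt_two))
  have hu2 := hu.eventually (gt_mem_nhds (by positivity : 0 < Δ / (8 * C)))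
  have hu3 := hu.eventually (gt_mem_nhds (by positivity : 0 < Δ / (384 * σ ^ 2)))
  filter_upwards [hnab, hp, hsu, hu1, hu2, hu3, eventually_gt_atTop 0]
    with n hn hnp hsn hun1 hun2 hun3 hn0
  set k : ℝ := ((min (na n) (nb n) : ℕ) : ℝ) with hk
  have hk0 : 0 < k := by rw [hk]; exact_mod_cast lt_min hn.1 hn.2
  have hkn : k ≤ n := by rw [hk]; exact_mod_cast (min_le_left _ _).trans (hna n)
  rw [div_lt_iff₀ hk0] at hun1 hun2 hun3
  -- For `u = 0` the dimensions may stay bounded and the tail bound need not be small; but then the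
  -- estimator is zero and no noise enters.
  rcases Nat.eq_zero_or_pos (u n) with hu0 | hupos
  · refine le_add_right (measure_mono_ae ?_)
    filter_upwards [hQ n] with ω hQω hω
    have hs0 : s n = 0 := by omega
    have hSω := hS n ω
    have hbω := hb n ω
    rw [hu0] at hbω
    rw [hs0] at hSω
    have h := sqNorm_mulVec_sub_mulVec_betaEW_zero_le (α n) hQω (Matrix.of (X n ω)) (μ n ω)
      (y n ω) (b n ω) hbω hSω
    have hω' : Δ ≤ |_| := hω
    rw [hu0, abs_of_nonneg (div_nonneg (sqNorm_nonneg _) hk0.le)] at hω'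
    change Δ / 16 ≤ |_|
    rw [abs_of_nonneg (div_nonneg (modelBias_nonneg _ _ _) hk0.le)]
    have h2 := div_le_div_of_nonneg_right h hk0.le
    linarith
  · have hup : u n ≤ p n := by
      have hlog2 := Real.log_pos one_lt_two
      have hlogp : Real.log 2 ≤ Real.log (p n) :=
        Real.log_le_log (by norm_num) (by exact_mod_cast (by omega : 2 ≤ p n))
      have h1 : (u n : ℝ) * Real.log 2 < k * Real.log 2 := by
        have := mul_le_mul_of_nonneg_left hlogp (Nat.cast_nonneg (α := ℝ) (u n))
        linarith
      have h2 : (u n : ℝ) < n := (lt_of_mul_lt_mul_right h1 hlog2.le).trans_le hkn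
      have h3 : u n < n := by exact_mod_cast h2
      omega
    -- Bias, noise and entropy then contribute at most `Δ k / 4` each, which is less than `Δ k` in
    -- total.
    set t : ℝ := Δ * k / (24 * σ ^ 2) with ht
    have ht0 : 0 ≤ t := by positivity
    have hσt : 6 * (σ ^ 2 * t) = Δ * k / 4 := by
      rw [ht]; field_simp; norm_num
    have hut : (u n : ℝ) * Real.log (p n) ≤ t / 16 := by
      refine hun3.le.trans_eq ?_
      rw [ht]; field_simp; norm_num
    have hcorr : P n {ω | IsCorrelated t (u n)
        (Matrix.fromRows (Matrix.of (A n ω)) (Matrix.of (B n ω))) (Matrix.of (X n ω)) (μ n ω)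
        (x n ω).ofLp} ≤ ENNReal.ofReal (1 / n) := by
      refine measure_prodMk_mem_le (hD n) (hx n) (hindep n)
        (isOpen_setOf_isCorrelated t (u n)).measurableSet ?_
      filter_upwards [hQ n] with ω hQω
      exact (stdGaussian_isCorrelated_le t (u n) hQω _ _).trans
        (ENNReal.ofReal_le_ofReal (card_models_mul_exp_le hn0 hnp hupos hut))
    refine le_trans (measure_mono_ae ?_) ((measure_union_le _ _).trans (add_le_add le_rfl hcorr))
    filter_upwards [hQ n, hy n] with ω hQω hyω hω
    by_contra hcon
    obtain ⟨h1, h2⟩ := not_or.mp hcon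
    have h1' : |modelBias (Matrix.of (X n ω)) (S n ω) (μ n ω) / k| < Δ / 16 := not_le.mp h1
    rw [abs_of_nonneg (div_nonneg (modelBias_nonneg _ _ _) hk0.le), div_lt_iff₀ hk0] at h1'
    have h := sqNorm_mulVec_sub_mulVec_betaEW_le (hα n) ht0 hQω (Matrix.of (X n ω)) (μ n ω)
      (x n ω).ofLp hyω (b n ω) (hb n ω) h2 (hS n ω) hsn hup
    have hω' : Δ ≤ |_| := hω
    rw [abs_of_nonneg (div_nonneg (sqNorm_nonneg _) hk0.le), le_div_iff₀ hk0] at hω'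
    have h3 : α n * Real.log (models (p n) (u n)).card ≤ Δ * k / 8 := by
      have h4 := log_card_models_le (hn0.trans hnp) (u n)
      have h5 : 0 ≤ (u n : ℝ) * Real.log (p n) := mul_nonneg (Nat.cast_nonneg _)
        (Real.log_nonneg (by exact_mod_cast hn0.trans hnp))
      calc α n * Real.log (models (p n) (u n)).card ≤ α n * (u n * Real.log (p n)) :=
            mul_le_mul_of_nonneg_left h4 (hα n).le
        _ ≤ C * (u n * Real.log (p n)) := mul_le_mul_of_nonneg_right (hαC n) h5
        _ ≤ C * (Δ / (8 * C) * k) := mul_le_mul_of_nonneg_left hun2.le hC0.le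
        _ = Δ * k / 8 := by field_simp
    nlinarith [mul_pos hΔ hk0]

/-! ### The limit of the F-statistic. -/

theorem theorem1
    -- the probability spaces and the dimensions, all depending on the number `n` of observations
    {Ω : ℕ → Type*} [∀ n, MeasurableSpace (Ω n)]
    (P : ∀ n, Measure (Ω n)) [∀ n, IsProbabilityMeasure (P n)]
    (p v r s u na nb : ℕ → ℕ)
    -- the fixed effects design and the random effects designs
    (X : ∀ n, Ω n → Matrix (Fin n) (Fin (p n)) ℝ)
    (Z : ∀ n, Ω n → Matrix (Fin n) (Fin (v n)) ℝ)
    (W : ∀ n, Ω n → Matrix (Fin n) (Fin (r n)) ℝ)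
    -- mean vector, random effects of interest, nuisance random effects, errors, response
    (μ : ∀ n, Ω n → Fin n → ℝ)
    (ν : ∀ n, Ω n → Fin (v n) → ℝ)
    (γ : ∀ n, Ω n → Fin (r n) → ℝ)
    (ε : ∀ n, Ω n → Fin n → ℝ)
    (Y : ∀ n, Ω n → Fin n → ℝ)
    (σ : ℝ) (hσ : 0 < σ)
    (Ψ : ∀ n, Matrix (Fin (v n)) (Fin (v n)) ℝ) (hΨ : ∀ n, (Ψ n).PosSemidef)
    (hY : ∀ n ω, Y n ω = μ n ω + (Z n ω).mulVec (ν n ω) + (W n ω).mulVec (γ n ω) + ε n ω)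
    (hε : ∀ n, HasLaw (fun ω => WithLp.toLp 2 (ε n ω))
      (multivariateGaussian 0 (σ ^ 2 • (1 : Matrix (Fin n) (Fin n) ℝ))) (P n))
    (hν : ∀ n, HasLaw (fun ω => WithLp.toLp 2 (ν n ω)) (multivariateGaussian 0 (Ψ n)) (P n))
    -- the matrices of the two reduced models
    (A : ∀ n, Ω n → Matrix (Fin (na n)) (Fin n) ℝ)
    (B : ∀ n, Ω n → Matrix (Fin (nb n)) (Fin n) ℝ)
    (hAB : ∀ n, ∀ᵐ ω ∂(P n),
      A n ω * (A n ω).transpose = 1 ∧ B n ω * (B n ω).transpose = 1 ∧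
      A n ω * (B n ω).transpose = 0 ∧
      A n ω * W n ω = 0 ∧ B n ω * W n ω = 0 ∧ B n ω * Z n ω = 0)
    (hnab : ∀ᶠ n in atTop, 0 < na n ∧ 0 < nb n)
    -- the design (with all that is determined by it) is measurable and independent of the errors
    (hX : ∀ n i j, Measurable fun ω => X n ω i j)
    (hZ : ∀ n i j, Measurable fun ω => Z n ω i j)
    (hW : ∀ n i j, Measurable fun ω => W n ω i j)
    (hμ : ∀ n i, Measurable fun ω => μ n ω i)
    (hA : ∀ n i j, Measurable fun ω => A n ω i j)
    (hB : ∀ n i j, Measurable fun ω => B n ω i j)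
    (hindep : ∀ n, IndepFun
      (fun ω => ((fun i j => X n ω i j, fun i j => Z n ω i j, fun i j => W n ω i j, μ n ω,
          fun i j => A n ω i j, fun i j => B n ω i j) :
        (Fin n → Fin (p n) → ℝ) × (Fin n → Fin (v n) → ℝ) × (Fin n → Fin (r n) → ℝ) ×
          (Fin n → ℝ) × (Fin (na n) → Fin n → ℝ) × (Fin (nb n) → Fin n → ℝ)))
      (ε n) (P n))
    -- high-dimensional fixed effects, weak sparsity
    (hp : ∀ᶠ n in atTop, n < p n)
    (hsparse : WeaklySparse P X μ s fun n => ((min (na n) (nb n) : ℕ) : ℝ))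
    -- the assumption (A2)
    (hus : (0 : EReal) ≤ liminf (fun n => (((u n : ℝ) - (s n : ℝ) : ℝ) : EReal)) atTop)
    (hu : Tendsto (fun n => (u n : ℝ) * Real.log (p n) / ((min (na n) (nb n) : ℕ) : ℝ))
      atTop (𝓝 0))
    -- the tuning parameter
    (α : ℕ → ℝ) (hα : ∀ n, 4 * σ ^ 2 ≤ α n) (hαbdd : BddAbove (Set.range α))
    -- least squares estimators in the models of size `u`, from the data `(QX, QY)`
    (b : ∀ n, Ω n → Finset (Fin (p n)) → Fin (p n) → ℝ)
    (hb : ∀ n ω, ∀ m ∈ models (p n) (u n),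
      IsLeastSquares (Matrix.fromRows (A n ω) (B n ω) * X n ω)
        ((Matrix.fromRows (A n ω) (B n ω)).mulVec (Y n ω)) m (b n ω m))
    -- the null hypothesis
    (hH0 : ∀ n, Ψ n = 0) :
    ∃ F : ∀ n, Ω n → ℝ,
      (∀ n, 0 < na n → 0 < nb n → HasLaw (F n) (fDistribution (na n) (nb n)) (P n)) ∧
      IsLittleOP P fun n ω =>
        fEW (α n) (u n) (A n ω) (B n ω) (X n ω) (Y n ω) (b n ω) - F n ω := by
  have hσ0 : σ ≠ 0 := hσ.ne'
  let e : ∀ n, Ω n → EuclideanSpace ℝ (Fin n) := fun n ω => WithLp.toLp 2 (σ⁻¹ • ε n ω)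
  have hεe : ∀ n ω, ε n ω = σ • (e n ω).ofLp := fun n ω => by
    simp [e, smul_smul, mul_inv_cancel₀ hσ0]
  have he : ∀ n, HasLaw (e n) (stdGaussian (EuclideanSpace ℝ (Fin n))) (P n) := fun n => by
    have h : HasLaw (fun z : EuclideanSpace ℝ (Fin n) => σ⁻¹ • z) (stdGaussian _)
        (multivariateGaussian 0 (σ ^ 2 • (1 : Matrix (Fin n) (Fin n) ℝ))) := by
      refine ⟨by fun_prop, ?_⟩
      rw [multivariateGaussian_zero_sq_smul_one, Measure.map_map (by fun_prop) (by fun_prop)]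
      simp [Function.comp_def, smul_smul, inv_mul_cancel₀ hσ0]
    exact h.comp (hε n)
  have hD : ∀ n, Measurable fun ω => ((fun i j => X n ω i j, μ n ω, fun i j => A n ω i j,
      fun i j => B n ω i j) : (Fin n → Fin (p n) → ℝ) × (Fin n → ℝ) × (Fin (na n) → Fin n → ℝ) ×
        (Fin (nb n) → Fin n → ℝ)) := fun n =>
    (measurable_pi_lambda _ fun i => measurable_pi_lambda _ fun j => hX n i j).prodMk
      ((measurable_pi_lambda _ fun i => hμ n i).prodMk
        ((measurable_pi_lambda _ fun i => measurable_pi_lambda _ fun j => hA n i j).prodMk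
          (measurable_pi_lambda _ fun i => measurable_pi_lambda _ fun j => hB n i j)))
  have hDe : ∀ n, IndepFun (fun ω => ((fun i j => X n ω i j, μ n ω, fun i j => A n ω i j,
      fun i j => B n ω i j) : (Fin n → Fin (p n) → ℝ) × (Fin n → ℝ) × (Fin (na n) → Fin n → ℝ) ×
        (Fin (nb n) → Fin n → ℝ))) (e n) (P n) := fun n =>
    (hindep n).comp (φ := fun z => (z.1, z.2.2.2.1, z.2.2.2.2.1, z.2.2.2.2.2))
      (ψ := fun z => WithLp.toLp 2 (σ⁻¹ • z)) (by fun_prop) (by fun_prop)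
  have hQ : ∀ n, ∀ᵐ ω ∂(P n), Matrix.fromRows (A n ω) (B n ω) *
      (Matrix.fromRows (A n ω) (B n ω)).transpose = 1 := fun n => by
    filter_upwards [hAB n] with ω hω
    exact fromRows_mul_transpose_eq_one hω.1 hω.2.1 hω.2.2.1
  have hν0 : ∀ n, ∀ᵐ ω ∂(P n), ν n ω = 0 := fun n => by
    have h := hν n
    rw [hH0 n, show multivariateGaussian 0 (0 : Matrix (Fin (v n)) (Fin (v n)) ℝ)
      = Measure.dirac 0 by simp [multivariateGaussian]] at h
    filter_upwards [h.ae_eq_of_dirac] with ω hω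
    exact congrArg WithLp.ofLp hω
  have hQY : ∀ n, ∀ᵐ ω ∂(P n), (Matrix.fromRows (A n ω) (B n ω)).mulVec (Y n ω) =
      (Matrix.fromRows (A n ω) (B n ω)).mulVec (μ n ω) +
        σ • (Matrix.fromRows (A n ω) (B n ω)).mulVec (e n ω).ofLp := fun n => by
    filter_upwards [hAB n, hν0 n] with ω hω hνω
    have hQW : Matrix.fromRows (A n ω) (B n ω) * W n ω = 0 := by
      rw [Matrix.fromRows_mul, hω.2.2.2.1, hω.2.2.2.2.1, Matrix.fromRows_zero]
    rw [hY, hνω, Matrix.mulVec_zero, add_zero, Matrix.mulVec_add, Matrix.mulVec_add,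
      Matrix.mulVec_mulVec, hQW, Matrix.zero_mulVec, add_zero, hεe, Matrix.mulVec_smul]
  have hna : ∀ n, na n ≤ n := fun n => by
    obtain ⟨ω, hω⟩ := (hAB n).exists
    exact le_of_mul_transpose_eq_one hω.1
  have hsu : ∀ᶠ n in atTop, s n ≤ u n := by
    -- An integer difference `u - s` exceeding `-1` is nonnegative.
    have h : ((-1 : ℝ) : EReal) < liminf (fun n => (((u n : ℝ) - (s n : ℝ) : ℝ) : EReal)) atTop :=
      lt_of_lt_of_le (by exact_mod_cast neg_one_lt_zero) hus
    filter_upwards [eventually_lt_of_lt_liminf h] with n hn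
    have h1 : (-1 : ℝ) < (u n : ℝ) - s n := EReal.coe_lt_coe_iff.mp hn
    have h2 : (s n : ℝ) < (u n + 1 : ℕ) := by push_cast; linarith
    exact Nat.lt_succ_iff.mp (by exact_mod_cast h2)
  have hcons := isLittleOP_sqNorm_mulVec_sub_mulVec_betaEW (X := fun n ω i j => X n ω i j)
    (A := fun n ω i j => A n ω i j) (B := fun n ω i j => B n ω i j)
    (y := fun n ω => (Matrix.fromRows (A n ω) (B n ω)).mulVec (Y n ω))
    hσ hD he hDe hQ hQY hnab hna hp hsparse hsu hu
    (fun n => lt_of_lt_of_le (by positivity) (hα n)) hαbdd hb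
  -- The joint law yields the exact F distribution, through independence of the two blocks; the
  -- marginal laws after it feed the stability lemma.
  have hξ : ∀ n, HasLaw (fun ω => (Matrix.fromRows (A n ω) (B n ω)).mulVec (e n ω).ofLp)
      (Measure.pi fun _ => gaussianReal 0 1) (P n) := fun n => by
    refine hasLaw_of_ae_map_eq (T := fun z x => (Matrix.fromRows (Matrix.of z.2.2.1)
      (Matrix.of z.2.2.2)).mulVec x.ofLp) (hD n) (he n) (hDe n) ?_ ?_
    · refine measurable_pi_iff.mpr fun i => ?_
      cases i <;>
      · simp only [Function.uncurry_def, Matrix.mulVec, dotProduct, Matrix.fromRows_apply_inl,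
          Matrix.fromRows_apply_inr, Matrix.of_apply]
        fun_prop
    · filter_upwards [hQ n] with ω hω
      exact map_mulVec_stdGaussian hω
  have hξA : ∀ n, HasLaw (fun ω => (A n ω).mulVec (e n ω).ofLp)
      (Measure.pi fun _ => gaussianReal 0 1) (P n) := fun n => by
    refine hasLaw_of_ae_map_eq (T := fun z x => (Matrix.of z.2.2.1).mulVec x.ofLp)
      (hD n) (he n) (hDe n) ?_ ?_
    · refine measurable_pi_iff.mpr fun i => ?_
      simp only [Function.uncurry_def, Matrix.mulVec, dotProduct, Matrix.of_apply]
      fun_prop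
    · filter_upwards [hAB n] with ω hω
      exact map_mulVec_stdGaussian hω.1
  have hξB : ∀ n, HasLaw (fun ω => (B n ω).mulVec (e n ω).ofLp)
      (Measure.pi fun _ => gaussianReal 0 1) (P n) := fun n => by
    refine hasLaw_of_ae_map_eq (T := fun z x => (Matrix.of z.2.2.2).mulVec x.ofLp)
      (hD n) (he n) (hDe n) ?_ ?_
    · refine measurable_pi_iff.mpr fun i => ?_
      simp only [Function.uncurry_def, Matrix.mulVec, dotProduct, Matrix.of_apply]
      fun_prop
    · filter_upwards [hAB n] with ω hω
      exact map_mulVec_stdGaussian hω.2.1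
  let β : ∀ n, Ω n → Fin (p n) → ℝ := fun n ω =>
    betaEW (α n) (u n) (Matrix.fromRows (A n ω) (B n ω) * X n ω)
      ((Matrix.fromRows (A n ω) (B n ω)).mulVec (Y n ω)) (b n ω)
  refine ⟨fun n ω => (sqNorm ((A n ω).mulVec (e n ω).ofLp) / na n) /
    (sqNorm ((B n ω).mulVec (e n ω).ofLp) / nb n), fun n _ _ => ?_, ?_⟩
  · refine (hasLaw_fDistribution (hξ n)).congr (ae_of_all _ fun ω => ?_)
    simp only [Matrix.fromRows_mulVec, Sum.elim_inl, Sum.elim_inr]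
  · have hlim := isLittleOP_meanSquare_ratio hnab hξA hξB
      (d := fun n ω => σ⁻¹ • ((A n ω).mulVec (μ n ω) - (A n ω * X n ω).mulVec (β n ω)))
      (d' := fun n ω => σ⁻¹ • ((B n ω).mulVec (μ n ω) - (B n ω * X n ω).mulVec (β n ω))) ?_
    · refine hlim.congr fun n => ?_
      filter_upwards [hQY n] with ω hω
      -- Both residuals carry a factor `σ`, so `σ ^ 2` drops out of the ratio.
      have hcancel : ∀ {d : ℕ} (M : Matrix (Fin d) (Fin n) ℝ),
          M.mulVec (Y n ω) = M.mulVec (μ n ω) + σ • M.mulVec (e n ω).ofLp →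
          M.mulVec (Y n ω) - (M * X n ω).mulVec (β n ω) = σ • (M.mulVec (e n ω).ofLp +
            σ⁻¹ • (M.mulVec (μ n ω) - (M * X n ω).mulVec (β n ω))) := by
        intro d M hM
        rw [hM, smul_add, smul_smul, mul_inv_cancel₀ hσ0, one_smul]
        abel
      simp only [Matrix.fromRows_mulVec] at hω
      have hA' := hcancel (A n ω) (funext fun i => congrFun hω (Sum.inl i))
      have hB' := hcancel (B n ω) (funext fun i => congrFun hω (Sum.inr i))
      change _ = (sqNorm ((A n ω).mulVec (Y n ω) - (A n ω * X n ω).mulVec (β n ω)) / na n) /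
        (sqNorm ((B n ω).mulVec (Y n ω) - (B n ω * X n ω).mulVec (β n ω)) / nb n) - _
      have hscale : ∀ w z c d : ℝ, (σ ^ 2 * w / c) / (σ ^ 2 * z / d) = (w / c) / (z / d) :=
        fun w z c d => by
          rw [mul_div_assoc _ w, mul_div_assoc _ z, mul_div_mul_left _ _ (pow_ne_zero 2 hσ0)]
      rw [hA', hB', sqNorm_smul, sqNorm_smul, hscale]
    · refine (hcons.const_mul (by positivity : 0 < σ⁻¹ ^ 2)).congr fun n => ae_of_all _ fun ω => ?_
      have hsplit : sqNorm ((Matrix.fromRows (A n ω) (B n ω)).mulVec (μ n ω) -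
          (Matrix.fromRows (A n ω) (B n ω) * X n ω).mulVec (β n ω)) =
          sqNorm ((A n ω).mulVec (μ n ω) - (A n ω * X n ω).mulVec (β n ω)) +
            sqNorm ((B n ω).mulVec (μ n ω) - (B n ω * X n ω).mulVec (β n ω)) := by
        simp [sqNorm, Fintype.sum_sum_type, Matrix.fromRows_mul, Matrix.fromRows_mulVec]
      refine (congrArg (fun z => σ⁻¹ ^ 2 * (z / ((min (na n) (nb n) : ℕ) : ℝ))) hsplit).trans ?_
      simp only [sqNorm_smul]
      ring
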